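/- Let $\mathfrak R$ be an associative unital $\mathbb C$-algebra, $n\ge 0$ an integer and $q\in\mathbb C\setminus\{0\}$. Let $E_{ij}$ be the standard $n\times n$ matrices and let $$R(z)=\frac1{z-1}\Bigl((qz-q^{-1})\sum_{i}E_{ii}\otimes E_{ii}+(z-1)\sum_{i\neq j}E_{ii}\otimes E_{jj}+(q-q^{-1})\sum_{i<j}\bigl(z\,E_{ij}\otimes E_{ji}+E_{ji}\otimes E_{ij}\bigr)\Bigr)$$ be the trigonometric $R$-matrix. An $n\times n$ matrix $L(z)$ over $\mathfrak R$ depending on a parameter $z$ is an $L$-operator if $$R(z/w)\,L^{(1)}(z)L^{(2)}(w)=L^{(2)}(w)L^{(1)}(z)\,R(z/w),\qquad L^{(1)}=L\otimes 1,\quad L^{(2)}=1\otimes L.$$ For $n\times n$ matrices put $(A*_qB)_{ik}=\sum_j q^{\mathrm{sgn}(j-i)}A_{ij}B_{jk}$, define the quantum powers by $L^{[0]}(z)=1$, $L^{[m]}(z)=L^{[m-1]}(z)*_qL(q^{2(m-1)}z)$, and set $$I_k(z)=\mathrm{tr}\,L^{[k]}(z).$$ Let $\pi_q$ be the representation of the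 symmetric group $\mathfrak S_k$ on $(\mathbb C^n)^{\otimes k}$ in which the transposition of neighbouring positions acts on the two corresponding tensor factors by $e_i\otimes e_j\mapsto q^{-\mathrm{sgn}(i-j)}e_j\otimes e_i$, let $A^q_k=\frac1{k!}\sum_{\tau\in\mathfrak S_k}(-1)^\tau\pi_q(\tau)$, and let $$t_k(z)=\mathrm{tr}_{1,\dots,k}\bigl(A^q_k\,L^{(1)}(z)L^{(2)}(q^2z)\cdots L^{(k)}(q^{2(k-1)}z)\bigr)$$ be the transfer functions. Then for all integers $k,l\ge1$ $$I_k(z)I_l(w)=I_l(w)I_k(z),\qquad I_k(z)\,t_l(w)=t_l(w)I_k(z)\qquad(\ast)$$ in each of the following settings. 1. *Formal series.* The entries of $L(z)$ lie in $\mathfrak R((z))$, or they all lie in $\mathfrak R((z^{-1}))$, and the $RLL$ relation holds as an identity of formal series in $z,w$ (after multiplication by $z-w$). Then $(\ast)$ holds as an identity of formal series, i.e. all coefficients of $I_k$ commute with all coefficients of $I_l$ and of $t_l$. 2. *Functions.* $L$ is a function on a set $D\subseteq\mathbb C\setminus\{0\}$, and the $RLL$ relation holds for all distinct $z,w\in D$.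 Then $(\ast)$ holds for all $z,w$ with $z,q^2z,\dots,q^{2(k-1)}z\in D$ and $w,q^2w,\dots,q^{2(l-1)}w\in D$, provided that $w\ne q^{2s}z$ for all integers $s$ with $-l\le s\le k$. 3. *Continuous functions.* If, in setting 2, $\mathfrak R$ is moreover a Hausdorff topological ring, $D$ is open and $L$ is continuous on $D$, then $(\ast)$ holds for all $z,w$ with $z,\dots,q^{2(k-1)}z\in D$ and $w,\dots,q^{2(l-1)}w\in D$, without the last proviso. -/

import Mathlib

open scoped Kronecker

namespace QLax

noncomputable section

/-! ### The trigonometric `R`-matrix -/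

/-- The standard matrix `E_{ij}`. -/
def E {n : ℕ} (i j : Fin n) : Matrix (Fin n) (Fin n) ℂ := Matrix.single i j 1

/-- The homogeneous numerator `(u - v) R(u/v)` of the trigonometric `R`-matrix, a matrix acting
on `ℂⁿ ⊗ ℂⁿ` (basis indexed by `Fin n × Fin n`), linear in `(u, v)`. -/
def Rnum (n : ℕ) (q u v : ℂ) : Matrix (Fin n × Fin n) (Fin n × Fin n) ℂ :=
  (q * u - q⁻¹ * v) • ∑ i : Fin n, (E i i ⊗ₖ E i i)
    + (u - v) • ∑ i : Fin n, ∑ j : Fin n, (if i ≠ j then E i i ⊗ₖ E j j else 0)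
    + (q - q⁻¹) • ∑ i : Fin n, ∑ j : Fin n,
        (if i < j then u • (E i j ⊗ₖ E j i) + v • (E j i ⊗ₖ E i j) else 0)

/-- The trigonometric `R`-matrix `R(z)`. -/
def Rmat (n : ℕ) (q z : ℂ) : Matrix (Fin n × Fin n) (Fin n × Fin n) ℂ :=
  (z - 1)⁻¹ • Rnum n q z 1

theorem smul_Rmat_div (n : ℕ) (q u v : ℂ) (hv : v ≠ 0) (huv : u ≠ v) :
    (u - v) • Rmat n q (u / v) = Rnum n q u v := by
  have h1 : u - v ≠ 0 := sub_ne_zero.2 huv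
  have h2 : u / v - 1 = (u - v) / v := by field_simp
  have h3 : (u - v) * (u / v - 1)⁻¹ = v := by
    rw [h2]; field_simp
  rw [Rmat, smul_smul, h3]
  simp only [Rnum, smul_add, smul_smul, Finset.smul_sum, smul_ite, smul_zero]
  have e1 : v * (q * (u / v) - q⁻¹ * 1) = q * u - q⁻¹ * v := by field_simp
  have e2 : v * (u / v - 1) = u - v := by field_simp
  have e3 : v * ((q - q⁻¹) * (u / v)) = (q - q⁻¹) * u := by
    have h4 : v * (u / v) = u := by field_simp
    calc v * ((q - q⁻¹) * (u / v)) = (q - q⁻¹) * (v * (u / v)) := by ring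
      _ = _ := by rw [h4]
  have e4 : v * ((q - q⁻¹) * 1) = (q - q⁻¹) * v := by ring
  simp only [e1, e2, e3, e4]

/-- A complex matrix viewed as a matrix over a `ℂ`-algebra. -/
abbrev scalar (S : Type*) [Ring S] [Algebra ℂ S] {ι κ : Type*} (A : Matrix ι κ ℂ) :
    Matrix ι κ S :=
  A.map (algebraMap ℂ S)

/-! ### The `q`-product, quantum powers -/

section Algebra

variable {S : Type*} [Ring S] [Algebra ℂ S]

/-- The product `(A *_q B)_{ik} = ∑_j q^{sgn(j-i)} A_{ij} B_{jk}`. -/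
def qMul {n : ℕ} (q : ℂ) (A B : Matrix (Fin n) (Fin n) S) : Matrix (Fin n) (Fin n) S :=
  Matrix.of fun i k => ∑ j : Fin n, (q ^ Int.sign ((j : ℤ) - (i : ℤ))) • (A i j * B j k)

/-- `(…((M₀ *_q M₁) *_q M₂) *_q … *_q M_{k-1})`, the identity matrix for `k = 0`.  With
`M_s = L(q^{2s} z)` this is the quantum power `L^{[k]}(z)`. -/
def qPow {n : ℕ} (q : ℂ) (M : ℕ → Matrix (Fin n) (Fin n) S) : ℕ → Matrix (Fin n) (Fin n) S
  | 0 => 1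
  | k + 1 => qMul q (qPow q M k) (M k)

/-- With `M_s = L(q^{2s} z)` this is `I_k(z) = tr L^{[k]}(z)`. -/
def qPowTrace {n : ℕ} (q : ℂ) (M : ℕ → Matrix (Fin n) (Fin n) S) (k : ℕ) : S :=
  (qPow q M k).trace

end Algebra

/-! ### The `q`-antisymmetrizer -/

/-- The scalar `c` with `π_q(τ) e_J = c • e_{J ∘ τ⁻¹}`. -/
def permWeight {n m : ℕ} (q : ℂ) (τ : Equiv.Perm (Fin m)) (J : Fin m → Fin n) : ℂ :=
  ∏ a : Fin m, ∏ b : Fin m,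
    if a < b ∧ τ b < τ a then q ^ (-Int.sign ((J a : ℤ) - (J b : ℤ))) else 1

/-- The representation `π_q` of the symmetric group on `(ℂⁿ)^{⊗ m}` (basis `e_J` indexed by
`J : Fin m → Fin n`).  It is the homomorphism whose value on each adjacent transposition is the
`q`-permutation operator `e_i ⊗ e_j ↦ q^{-sgn(i-j)} e_j ⊗ e_i` of the two adjacent factors;
see `qPerm_mul` and `qPerm_swap` below. -/
def qPerm (n : ℕ) {m : ℕ} (q : ℂ) (τ : Equiv.Perm (Fin m)) :
    Matrix (Fin m → Fin n) (Fin m → Fin n) ℂ :=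
  Matrix.of fun I J => if I = J ∘ τ.symm then permWeight q τ J else 0

/-- The `q`-antisymmetrizer `A^q_m = (1/m!) ∑_τ (-1)^τ π_q(τ)` on `(ℂⁿ)^{⊗ m}`. -/
def qAntisymm (n m : ℕ) (q : ℂ) : Matrix (Fin m → Fin n) (Fin m → Fin n) ℂ :=
  ((m.factorial : ℂ)⁻¹) • ∑ τ : Equiv.Perm (Fin m), ((Equiv.Perm.sign τ : ℤ) : ℂ) • qPerm n q τ

section Legs

variable {S : Type*} [Ring S] [Algebra ℂ S]

/-- `M^{(s)}`: the matrix `M` acting in the `s`-th factor of `(ℂⁿ)^{⊗ m}`. -/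
def leg {n m : ℕ} (s : Fin m) (M : Matrix (Fin n) (Fin n) S) :
    Matrix (Fin m → Fin n) (Fin m → Fin n) S :=
  Matrix.of fun I J => if ∀ r, r ≠ s → I r = J r then M (I s) (J s) else 0

/-- `tr_{1,…,k} (A^q_k M₀^{(1)} M₁^{(2)} ⋯ M_{k-1}^{(k)})`.  With `M_s = L(q^{2s} z)` this is the
transfer function `t_k(z)`. -/
def antisymmTrace {n : ℕ} (q : ℂ) (M : ℕ → Matrix (Fin n) (Fin n) S) (k : ℕ) : S :=
  (scalar S (qAntisymm n k q) * (List.ofFn fun s : Fin k => leg s (M s)).prod).trace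

end Legs

/-! ### `L`-operators whose spectral parameter is a complex number -/

section Functions

variable {S : Type*} [Ring S] [Algebra ℂ S] {n : ℕ}

/-- `R(z/w) L^{(1)}(z) L^{(2)}(w) = L^{(2)}(w) L^{(1)}(z) R(z/w)` for all distinct `z, w ∈ D`. -/
def RLLOn (q : ℂ) (D : Set ℂ) (L : ℂ → Matrix (Fin n) (Fin n) S) : Prop :=
  ∀ z ∈ D, ∀ w ∈ D, z ≠ w →
    scalar S (Rmat n q (z / w)) * (L z ⊗ₖ (1 : Matrix (Fin n) (Fin n) S))
        * ((1 : Matrix (Fin n) (Fin n) S) ⊗ₖ L w)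
      = ((1 : Matrix (Fin n) (Fin n) S) ⊗ₖ L w)
        * (L z ⊗ₖ (1 : Matrix (Fin n) (Fin n) S)) * scalar S (Rmat n q (z / w))

/-- `I_k(z) = tr L^{[k]}(z)`. -/
def I (q : ℂ) (L : ℂ → Matrix (Fin n) (Fin n) S) (k : ℕ) (z : ℂ) : S :=
  qPowTrace q (fun s => L (q ^ (2 * s) * z)) k

/-- `t_k(z) = tr_{1,…,k} (A^q_k L^{(1)}(z) L^{(2)}(q² z) ⋯ L^{(k)}(q^{2(k-1)} z))`. -/
def t (q : ℂ) (L : ℂ → Matrix (Fin n) (Fin n) S) (k : ℕ) (z : ℂ) : S :=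
  antisymmTrace q (fun s => L (q ^ (2 * s) * z)) k

end Functions

/-! ### `L`-operators that are formal Laurent series

The formal variable of `LaurentSeries S` stands for `z ^ ε`, where `ε = 1` or `ε = -1`; so
`ε = 1` gives the series in `S((z))` and `ε = -1` those in `S((z⁻¹))`. -/

section Formal

variable {S : Type*} [Ring S] [Algebra ℂ S] {n : ℕ}

/-- `f(x) ↦ f(c x)`. -/
def scale (c : ℂ) (f : LaurentSeries S) : LaurentSeries S where
  coeff m := c ^ m • f.coeff m
  isPWO_support' := f.isPWO_support.mono fun m hm h => hm (by
    show c ^ m • f.coeff m = 0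
    rw [h, smul_zero])

/-- The coefficient of `z ^ p` in `L(z)`. -/
def zCoeff (ε : ℤˣ) (L : Matrix (Fin n) (Fin n) (LaurentSeries S)) (p : ℤ) :
    Matrix (Fin n) (Fin n) S :=
  L.map fun f => f.coeff ((ε : ℤ) * p)

/-- The coefficient of `z ^ p * w ^ r` in `L^{(1)}(z) L^{(2)}(w)`. -/
def coeff12 (ε : ℤˣ) (L : Matrix (Fin n) (Fin n) (LaurentSeries S)) (p r : ℤ) :
    Matrix (Fin n × Fin n) (Fin n × Fin n) S :=
  (zCoeff ε L p ⊗ₖ (1 : Matrix (Fin n) (Fin n) S))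
    * ((1 : Matrix (Fin n) (Fin n) S) ⊗ₖ zCoeff ε L r)

/-- The coefficient of `z ^ p * w ^ r` in `L^{(2)}(w) L^{(1)}(z)`. -/
def coeff21 (ε : ℤˣ) (L : Matrix (Fin n) (Fin n) (LaurentSeries S)) (p r : ℤ) :
    Matrix (Fin n × Fin n) (Fin n × Fin n) S :=
  ((1 : Matrix (Fin n) (Fin n) S) ⊗ₖ zCoeff ε L r)
    * (zCoeff ε L p ⊗ₖ (1 : Matrix (Fin n) (Fin n) S))

/-- The relation `R(z/w) L^{(1)}(z) L^{(2)}(w) = L^{(2)}(w) L^{(1)}(z) R(z/w)` for formal Laurent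
series, multiplied by `z - w` (a non-zero-divisor here) and read off at each `z ^ p * w ^ r`; note
that `(z - w) R(z/w) = z * Rnum n q 1 0 + w * Rnum n q 0 1`. -/
def RLLFormal (q : ℂ) (ε : ℤˣ) (L : Matrix (Fin n) (Fin n) (LaurentSeries S)) : Prop :=
  ∀ p r : ℤ,
    scalar S (Rnum n q 1 0) * coeff12 ε L (p - 1) r
        + scalar S (Rnum n q 0 1) * coeff12 ε L p (r - 1)
      = coeff21 ε L (p - 1) r * scalar S (Rnum n q 1 0)
        + coeff21 ε L p (r - 1) * scalar S (Rnum n q 0 1)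

/-- The sequence `L(z), L(q² z), L(q⁴ z), …` of matrices of Laurent series in `z ^ ε`. -/
def formalShift (q : ℂ) (ε : ℤˣ) (L : Matrix (Fin n) (Fin n) (LaurentSeries S)) (s : ℕ) :
    Matrix (Fin n) (Fin n) (LaurentSeries S) :=
  L.map (scale ((q ^ (2 * s)) ^ (ε : ℤ)))

/-- The series `I_k(z) = tr L^{[k]}(z)`. -/
def formalI (q : ℂ) (ε : ℤˣ) (L : Matrix (Fin n) (Fin n) (LaurentSeries S)) (k : ℕ) :
    LaurentSeries S :=
  qPowTrace q (formalShift q ε L) k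

/-- The series `t_k(z) = tr_{1,…,k} (A^q_k L^{(1)}(z) L^{(2)}(q² z) ⋯ L^{(k)}(q^{2(k-1)} z))`. -/
def formalT (q : ℂ) (ε : ℤˣ) (L : Matrix (Fin n) (Fin n) (LaurentSeries S)) (k : ℕ) :
    LaurentSeries S :=
  antisymmTrace q (formalShift q ε L) k

end Formal

/-! ### `π_q` is the representation described above -/

section Rep

theorem prod_prod_eq_of_diag {m : ℕ} (F : Fin m → Fin m → ℂ) (hF : ∀ a, F a a = 1) :
    ∏ a, ∏ b, F a b = ∏ a, ∏ b, if a < b then F a b * F b a else 1 := by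
  have h1 : ∏ a, ∏ b, F a b
      = (∏ a, ∏ b, if a < b then F a b else 1) * ∏ a, ∏ b, if b < a then F a b else 1 := by
    simp only [← Finset.prod_mul_distrib]
    refine Finset.prod_congr rfl fun a _ => Finset.prod_congr rfl fun b _ => ?_
    rcases lt_trichotomy a b with h | h | h
    · simp [h, h.not_gt]
    · subst h; simp [hF]
    · simp [h, h.not_gt]
  rw [h1, Finset.prod_comm (f := fun a b => if b < a then F a b else 1)]
  simp only [← Finset.prod_mul_distrib]
  refine Finset.prod_congr rfl fun a _ => Finset.prod_congr rfl fun b _ => ?_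
  split_ifs <;> simp

theorem permWeight_mul {n m : ℕ} {q : ℂ} (hq : q ≠ 0) (σ τ : Equiv.Perm (Fin m))
    (J : Fin m → Fin n) :
    permWeight q (σ * τ) J = permWeight q σ (J ∘ τ.symm) * permWeight q τ J := by
  set g : Fin m → Fin m → ℂ := fun a b => q ^ (-Int.sign ((J a : ℤ) - (J b : ℤ))) with hg
  have hgg : ∀ a b, g a b * g b a = 1 := fun a b => by
    simp only [hg]
    rw [← zpow_add₀ hq, ← neg_sub (J a : ℤ) (J b : ℤ), Int.sign_neg]
    simp
  have hgg' : ∀ a b, 1 = g a b * g b a := fun a b => (hgg a b).symm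
  have h1 : permWeight q σ (J ∘ τ.symm)
      = ∏ a, ∏ b, if τ a < τ b ∧ σ (τ b) < σ (τ a) then g a b else 1 := by
    unfold permWeight
    rw [← Equiv.prod_comp τ]
    refine Finset.prod_congr rfl fun a _ => ?_
    rw [← Equiv.prod_comp τ]
    simp [hg]
  have h2 : permWeight q τ J = ∏ a, ∏ b, if a < b ∧ τ b < τ a then g a b else 1 := rfl
  have h3 : permWeight q (σ * τ) J
      = ∏ a, ∏ b, if a < b ∧ σ (τ b) < σ (τ a) then g a b else 1 := rfl
  rw [h1, h2, h3]
  simp only [← Finset.prod_mul_distrib]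
  rw [prod_prod_eq_of_diag _ (fun a => by simp), prod_prod_eq_of_diag
    (fun a b => (if τ a < τ b ∧ σ (τ b) < σ (τ a) then g a b else 1)
      * if a < b ∧ τ b < τ a then g a b else 1) (fun a => by simp)]
  refine Finset.prod_congr rfl fun a _ => Finset.prod_congr rfl fun b _ => ?_
  by_cases hab : a < b
  · have n1 : τ a ≠ τ b := fun h => hab.ne (τ.injective h)
    have n2 : σ (τ a) ≠ σ (τ b) := fun h => n1 (σ.injective h)
    rcases lt_or_gt_of_ne n1 with h | h <;> rcases lt_or_gt_of_ne n2 with h' | h' <;>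
      simp [hab, hab.not_gt, h, h.not_gt, h', h'.not_gt, hgg, mul_comm]
  · simp [hab]

theorem qPerm_mul (n : ℕ) {m : ℕ} {q : ℂ} (hq : q ≠ 0) (σ τ : Equiv.Perm (Fin m)) :
    qPerm n q (σ * τ) = qPerm n q σ * qPerm n q τ := by
  ext I J
  simp only [qPerm, Matrix.mul_apply, Matrix.of_apply, mul_ite, mul_zero, Finset.sum_ite_eq',
    Finset.mem_univ, if_true]
  rw [permWeight_mul hq]
  have : J ∘ (σ * τ).symm = (J ∘ τ.symm) ∘ σ.symm := by
    ext x; rfl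
  rw [this]
  split_ifs <;> simp

theorem qPerm_swap (n : ℕ) {m : ℕ} (q : ℂ) (a b : Fin m) (hab : (b : ℕ) = a + 1)
    (I J : Fin m → Fin n) :
    qPerm n q (Equiv.swap a b) I J
      = if I = J ∘ Equiv.swap a b then q ^ (-Int.sign ((J a : ℤ) - (J b : ℤ))) else 0 := by
  have hlt : a < b := by rw [Fin.lt_def]; omega
  have key : permWeight q (Equiv.swap a b) J = q ^ (-Int.sign ((J a : ℤ) - (J b : ℤ))) := by
    unfold permWeight
    rw [Finset.prod_eq_single a, Finset.prod_eq_single b]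
    · simp [hlt]
    · intro d _ hd
      refine if_neg ?_
      rintro ⟨h1, h2⟩
      rw [Equiv.swap_apply_left, Equiv.swap_apply_of_ne_of_ne h1.ne' hd] at h2
      rw [Fin.lt_def] at h1 h2
      omega
    · simp
    · intro c _ hc
      refine Finset.prod_eq_one fun d _ => if_neg ?_
      rintro ⟨h1, h2⟩
      have hcv : (c : ℕ) ≠ a := fun h => hc (Fin.ext h)
      rw [Equiv.swap_apply_def, Equiv.swap_apply_def] at h2
      split_ifs at h2 <;> simp only [Fin.lt_def, Fin.ext_iff] at * <;> omega
    · simp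
  simp only [qPerm, Matrix.of_apply, key, Equiv.symm_swap]

end Rep

end

end QLax

/-!
For two strings of parameters `z, q²z, …` and `w, q²w, …` the product of the `R`-matrices over all
pairs intertwines the products of the `L`-operators over the two strings. By the Yang–Baxter
equation it is compatible with the `q`-antisymmetrizers, since `1 - π_q(s)` is a multiple of
`R(q⁻²)` for an adjacent transposition `s`; taking traces gives `[t_k(z), t_l(w)] = 0`. Newton's
identities express the quantum power sums `I_k` recursively through the transfer functions along
shorter strings, which extends commutativity to the `I_k`. This needs `q² ≠ 1`; for `q² = 1` the
`RLL` relation says that the entries of `L(z)` and `L(w)` commute up to a sign depending on their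
indices, and these signs cancel in the traces.

All of this is carried out for finite sequences of matrices with parameters in a commutative ring
`K` acting on the coefficients. Functions of a complex parameter are the case `K = ℂ`, where
continuity removes the exceptional parameters, and formal series are the case `K = ℂ((z))((w))`.
-/

open Set (range EqOn)

namespace QLax

noncomputable section

/-! ### Operators on tensor powers with noncommutative coefficients -/

section Labels

variable {α ι : Type*}

theorem range_punit (a : ι) : range (Function.Embedding.punit a : Unit ↪ ι) = {a} :=
  Set.range_const (c := a)

/-- Two distinct labels as an embedding of `Fin 2`. -/
def pairEmbedding {a b : ι} (hab : a ≠ b) : Fin 2 ↪ ι :=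
  ⟨![a, b], by simpa [Function.Injective, Fin.forall_fin_two] using ⟨hab, hab.symm⟩⟩

theorem range_pairEmbedding {a b : ι} (hab : a ≠ b) : range (pairEmbedding hab) = {a, b} := by
  simp [pairEmbedding, Set.pair_comm]

theorem comp_swap_comp_swap [DecidableEq ι] (a b : ι) (I : ι → α) :
    (I ∘ Equiv.swap a b) ∘ Equiv.swap a b = I := by
  rw [Function.comp_assoc, ← Equiv.coe_trans, Equiv.swap_swap, Equiv.coe_refl, Function.comp_id]

theorem eq_comp_swap_iff [DecidableEq ι] (a b : ι) (I J : ι → α) :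
    J = I ∘ Equiv.swap a b ↔ I = J ∘ Equiv.swap a b := by
  constructor <;> (rintro rfl; rw [comp_swap_comp_swap])

theorem comp_swap_of_eq [DecidableEq ι] {a b : ι} {I : ι → α} (h : I a = I b) :
    I ∘ Equiv.swap a b = I := by
  rw [Equiv.comp_swap_eq_update, h, Function.update_eq_self, ← h, Function.update_eq_self]

end Labels

section Factors

variable {T α ι κ κ' : Type*} [Ring T] [Fintype α] [DecidableEq α]
  [Fintype ι] [DecidableEq ι] [Fintype κ] [DecidableEq κ] [Fintype κ'] [DecidableEq κ']

open scoped Classical in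
/-- The matrix `X`, an operator on the tensor power indexed by `κ`, acting in those factors of the
tensor power indexed by `ι` that are labelled by the range of `e`. -/
def onFactors (e : κ ↪ ι) :
    Matrix (κ → α) (κ → α) T →+* Matrix (ι → α) (ι → α) T :=
  (Matrix.reindexRingEquiv T <|
    ((Equiv.piEquivPiSubtypeProd (· ∈ range e) fun _ => α).trans <|
      ((Equiv.ofInjective e e.injective).arrowCongr (Equiv.refl α)).symm.prodCongr
        (Equiv.refl _)).symm : _ →+* _).comp <|
  (Matrix.blockDiagonalRingHom (κ → α) ({r // r ∉ range e} → α) T).comp <|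
  Pi.constRingHom _ _

open scoped Classical in
theorem onFactors_apply (e : κ ↪ ι) (X : Matrix (κ → α) (κ → α) T) (I J : ι → α) :
    onFactors e X I J = if EqOn I J (range e)ᶜ then X (I ∘ e) (J ∘ e) else 0 := by
  rw [← if_congr Set.domRestrict_eq_domRestrict_iff rfl rfl]
  rfl

theorem onFactors_apply_of_eqOn {e : κ ↪ ι} (X : Matrix (κ → α) (κ → α) T) {I J : ι → α}
    (h : EqOn I J (range e)ᶜ) : onFactors e X I J = X (I ∘ e) (J ∘ e) := by
  rw [onFactors_apply, if_pos h]

theorem onFactors_apply_of_not_eqOn {e : κ ↪ ι} (X : Matrix (κ → α) (κ → α) T) {I J : ι → α}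
    (h : ¬EqOn I J (range e)ᶜ) : onFactors e X I J = 0 := by
  rw [onFactors_apply, if_neg h]

theorem onFactors_smul {K : Type*} [CommRing K] [Algebra K T] (e : κ ↪ ι) (c : K)
    (X : Matrix (κ → α) (κ → α) T) : onFactors e (c • X) = c • onFactors e X := by
  ext I J
  simp only [onFactors_apply, Matrix.smul_apply, smul_ite, smul_zero]

theorem onFactors_refl (X : Matrix (ι → α) (ι → α) T) :
    onFactors (Function.Embedding.refl ι) X = X :=
  Matrix.ext fun _ _ => onFactors_apply_of_eqOn X fun r hr => (hr ⟨r, rfl⟩).elim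

theorem onFactors_onFactors (e : κ ↪ ι) (e' : κ' ↪ κ) (X : Matrix (κ' → α) (κ' → α) T) :
    onFactors e (onFactors e' X) = onFactors (e'.trans e) X := by
  classical
  ext I J
  simp only [onFactors_apply, ← ite_and]
  refine if_congr ⟨fun h r hr => ?_, fun h => ⟨fun r hr => h ?_, fun a ha => h ?_⟩⟩ rfl rfl
  · by_cases hr' : r ∈ range e
    · obtain ⟨a, rfl⟩ := hr'
      exact h.2 fun ⟨b, hb⟩ => hr ⟨b, congrArg e hb⟩
    · exact h.1 hr'
  · rintro ⟨b, rfl⟩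
    exact hr ⟨e' b, rfl⟩
  · rintro ⟨b, hb⟩
    exact ha ⟨b, e.injective hb⟩

open scoped Classical in
theorem onFactors_mul_onFactors_apply {e : κ ↪ ι} {e' : κ' ↪ ι}
    (hd : Disjoint (range e) (range e')) (X : Matrix (κ → α) (κ → α) T)
    (Y : Matrix (κ' → α) (κ' → α) T) (I J : ι → α) :
    (onFactors e X * onFactors e' Y) I J =
      if EqOn I J (range e ∪ range e')ᶜ then X (I ∘ e) (J ∘ e) * Y (I ∘ e') (J ∘ e') else 0 := by
  have hd' : ∀ r, r ∈ range e' → r ∉ range e := fun r h' h => Set.disjoint_left.1 hd h h'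
  set M : ι → α := (range e).piecewise J I with hM
  rw [Matrix.mul_apply, Finset.sum_eq_single M, onFactors_apply_of_eqOn, onFactors_apply]
  · have h1 : M ∘ e = J ∘ e := funext fun a => by simp [hM]
    have h2 : M ∘ e' = I ∘ e' := funext fun a => by simp [hM, hd' _ ⟨a, rfl⟩]
    have h3 : EqOn M J (range e')ᶜ ↔ EqOn I J (range e ∪ range e')ᶜ := by
      refine forall_congr' fun r => ?_
      by_cases hr : r ∈ range e <;> simp [hM, hr]
    rw [h1, h2, if_congr h3 rfl rfl, mul_ite, mul_zero]
  · exact fun r hr => (Set.piecewise_eq_of_notMem _ _ _ hr).symm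
  · intro K _ hK
    by_cases h : EqOn I K (range e)ᶜ
    · rw [onFactors_apply_of_not_eqOn Y, mul_zero]
      refine fun h' => hK (funext fun r => ?_)
      by_cases hr : r ∈ range e
      · rw [hM, Set.piecewise_eq_of_mem _ _ _ hr, h' fun hr' => hd' r hr' hr]
      · rw [hM, Set.piecewise_eq_of_notMem _ _ _ hr, h hr]
    · rw [onFactors_apply_of_not_eqOn X h, zero_mul]
  · simp

theorem onFactors_commute_onFactors {e : κ ↪ ι} {e' : κ' ↪ ι}
    (hd : Disjoint (range e) (range e')) {X : Matrix (κ → α) (κ → α) T}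
    (hX : X ∈ (Subring.center T).matrix) (Y : Matrix (κ' → α) (κ' → α) T) :
    Commute (onFactors e X) (onFactors e' Y) := by
  classical
  ext I J
  rw [onFactors_mul_onFactors_apply hd, onFactors_mul_onFactors_apply hd.symm, Set.union_comm,
    Subring.mem_center_iff.1 (hX _ _)]

/-- The matrix `A` acting in the tensor factor labelled by `a`. -/
def onFactor (a : ι) : Matrix α α T →+* Matrix (ι → α) (ι → α) T :=
  (onFactors (Function.Embedding.punit a : Unit ↪ ι)).comp
    (Matrix.reindexRingEquiv T (Equiv.funUnique Unit α).symm : _ →+* _)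

open scoped Classical in
theorem onFactor_apply (a : ι) (A : Matrix α α T) (I J : ι → α) :
    onFactor a A I J = if EqOn I J {a}ᶜ then A (I a) (J a) else 0 := by
  rw [← range_punit]
  exact onFactors_apply _ _ _ _

theorem leg_eq_onFactor {m n : ℕ} [Algebra ℂ T] (s : Fin m) (A : Matrix (Fin n) (Fin n) T) :
    leg s A = onFactor s A := by
  classical
  ext I J
  rw [onFactor_apply]
  exact if_congr Iff.rfl rfl rfl

theorem onFactors_onFactor (e : κ ↪ ι) (a : κ) (A : Matrix α α T) :
    onFactors e (onFactor a A) = onFactor (e a) A :=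
  onFactors_onFactors _ _ _

open scoped Classical in
theorem onFactors_mul_onFactor_apply {e : κ ↪ ι} {b : ι} (hb : b ∉ range e)
    (X : Matrix (κ → α) (κ → α) T) (B : Matrix α α T) (I J : ι → α) :
    (onFactors e X * onFactor b B) I J =
      if EqOn I J (insert b (range e))ᶜ then X (I ∘ e) (J ∘ e) * B (I b) (J b) else 0 := by
  rw [Set.insert_eq, Set.union_comm, ← range_punit]
  exact onFactors_mul_onFactors_apply (by simpa [range_punit] using hb) _ _ _ _

open scoped Classical in
theorem onFactor_mul_onFactor_apply {a b : ι} (hab : a ≠ b) (A B : Matrix α α T) (I J : ι → α) :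
    (onFactor a A * onFactor b B) I J =
      if EqOn I J {a, b}ᶜ then A (I a) (J a) * B (I b) (J b) else 0 := by
  rw [Set.insert_eq, ← range_punit, ← range_punit]
  exact onFactors_mul_onFactors_apply (by simpa [range_punit] using hab) _ _ _ _

end Factors

section SwapOperators

variable {T α ι κ K : Type*} [Ring T] [Fintype α] [DecidableEq α]
  [Fintype ι] [DecidableEq ι] [Fintype κ] [DecidableEq κ] [CommRing K] [Algebra K T]

/-- The operator acting on functions of `I : ι → α` by
`F ↦ f (I a) (I b) F(I) + g (I a) (I b) F(I ∘ swap a b)`. -/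
def swapOp (T : Type*) [Ring T] [Algebra K T] (a b : ι) (f g : α → α → K) :
    Matrix (ι → α) (ι → α) T :=
  Matrix.of fun I J => (if J = I then algebraMap K T (f (I a) (I b)) else 0)
    + (if J = I ∘ Equiv.swap a b then algebraMap K T (g (I a) (I b)) else 0)

theorem swapOp_mul_apply (a b : ι) (f g : α → α → K) (X : Matrix (ι → α) (ι → α) T)
    (I J : ι → α) :
    (swapOp T a b f g * X) I J
      = f (I a) (I b) • X I J + g (I a) (I b) • X (I ∘ Equiv.swap a b) J := by
  simp [swapOp, Matrix.mul_apply, add_mul, Finset.sum_add_distrib, Algebra.smul_def]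

theorem mul_swapOp_apply (a b : ι) (f g : α → α → K) (X : Matrix (ι → α) (ι → α) T)
    (I J : ι → α) :
    (X * swapOp T a b f g) I J
      = f (J a) (J b) • X I J + g (J b) (J a) • X I (J ∘ Equiv.swap a b) := by
  simp [swapOp, Matrix.mul_apply, mul_add, Finset.sum_add_distrib, Algebra.smul_def,
    eq_comp_swap_iff a b _ J, Algebra.commutes]

theorem swapOp_mem_matrix_center (a b : ι) (f g : α → α → K) :
    swapOp T a b f g ∈ (Subring.center T).matrix := by
  have h : ∀ (p : Prop) [Decidable p] (c : K),
      (if p then algebraMap K T c else 0) ∈ Subring.center T := by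
    intro p _ c
    split_ifs
    · exact Subring.mem_center_iff.2 fun x => (Algebra.commutes c x).symm
    · exact zero_mem _
  exact fun I J => add_mem (h _ _) (h _ _)

theorem onFactors_swapOp (e : κ ↪ ι) (a b : κ) (f g : α → α → K) :
    onFactors e (swapOp T a b f g) = swapOp T (e a) (e b) f g := by
  classical
  ext I J
  have hr : ∀ {r}, r ∉ range e → Equiv.swap (e a) (e b) r = r := fun hr =>
    Equiv.swap_apply_of_ne_of_ne (fun h => hr ⟨a, h.symm⟩) fun h => hr ⟨b, h.symm⟩
  have h : ∀ I' : ι → α, EqOn I I' (range e)ᶜ →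
      (J = I' ↔ EqOn I J (range e)ᶜ ∧ J ∘ e = I' ∘ e) := by
    refine fun I' h' => ⟨?_, fun h => funext fun r => ?_⟩
    · rintro rfl
      exact ⟨h', rfl⟩
    · by_cases hr : r ∈ range e
      · obtain ⟨a, rfl⟩ := hr
        exact congrFun h.2 a
      · rw [← h.1 hr, h' hr]
  have hI : (I ∘ Equiv.swap (e a) (e b)) ∘ e = (I ∘ e) ∘ Equiv.swap a b :=
    funext fun r => congrArg I (e.swap_apply a b r)
  simp only [onFactors_apply, swapOp, Matrix.of_apply, h I fun _ _ => rfl,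
    h (I ∘ Equiv.swap (e a) (e b)) fun _ h' => congrArg I (hr h').symm, hI, ite_and,
    Function.comp_apply]
  split_ifs <;> simp

theorem onFactors_pairEmbedding_swapOp {a b : ι} (hab : a ≠ b) (f g : α → α → K) :
    onFactors (pairEmbedding hab) (swapOp T 0 1 f g) = swapOp T a b f g :=
  onFactors_swapOp _ _ _ _ _

theorem swapOp_commute_onFactors {a b : ι} (hab : a ≠ b) {e : κ ↪ ι} (ha : a ∉ range e)
    (hb : b ∉ range e) (f g : α → α → K) (X : Matrix (κ → α) (κ → α) T) :
    Commute (swapOp T a b f g) (onFactors e X) := by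
  rw [← onFactors_pairEmbedding_swapOp hab]
  refine onFactors_commute_onFactors ?_ (swapOp_mem_matrix_center _ _ _ _) X
  rw [range_pairEmbedding]
  simp_all

theorem swapOp_commute_onFactor {a b c : ι} (hab : a ≠ b) (hca : c ≠ a) (hcb : c ≠ b)
    (f g : α → α → K) (A : Matrix α α T) : Commute (swapOp T a b f g) (onFactor c A) :=
  swapOp_commute_onFactors hab (by simpa [range_punit] using hca.symm)
    (by simpa [range_punit] using hcb.symm) _ _ _

theorem swapOp_commute_swapOp {K' : Type*} [CommRing K'] [Algebra K' T] {a b c d : ι} (hab : a ≠ b)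
    (hcd : c ≠ d) (hac : a ≠ c) (had : a ≠ d) (hbc : b ≠ c) (hbd : b ≠ d) (f g : α → α → K)
    (f' g' : α → α → K') : Commute (swapOp T a b f g) (swapOp T c d f' g') := by
  rw [← onFactors_pairEmbedding_swapOp hcd]
  exact swapOp_commute_onFactors hab (by simp [range_pairEmbedding, hac, had])
    (by simp [range_pairEmbedding, hbc, hbd]) _ _ _

/-- The relation `R A^{(1)} B^{(2)} = B^{(2)} A^{(1)} R`, written entrywise, for the operator `R`
on two tensor factors with diagonal coefficients `f` and permuting coefficients `g`. -/
def ExchangeRel (f g : α → α → K) (A B : Matrix α α T) : Prop :=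
  ∀ i j k l, f i k • (A i j * B k l) + g i k • (A k j * B i l)
    = f j l • (B k l * A i j) + g l j • (B k j * A i l)

theorem ExchangeRel.semiconjBy_swapOp {f g : α → α → K} {A B : Matrix α α T}
    (h : ExchangeRel f g A B) {a b : ι} (hab : a ≠ b) :
    SemiconjBy (swapOp T a b f g) (onFactor a A * onFactor b B) (onFactor b B * onFactor a A) := by
  classical
  ext I J
  have off : ∀ {r}, r ∈ ({a, b} : Set ι)ᶜ → Equiv.swap a b r = r := by
    intro r hr
    rw [Set.mem_compl_iff, Set.mem_insert_iff, Set.mem_singleton_iff, not_or] at hr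
    exact Equiv.swap_apply_of_ne_of_ne hr.1 hr.2
  have hI : EqOn (I ∘ Equiv.swap a b) J {a, b}ᶜ ↔ EqOn I J {a, b}ᶜ :=
    forall₂_congr fun r hr => by rw [Function.comp_apply, off hr]
  have hJ : EqOn I (J ∘ Equiv.swap a b) {a, b}ᶜ ↔ EqOn I J {a, b}ᶜ :=
    forall₂_congr fun r hr => by rw [Function.comp_apply, off hr]
  rw [swapOp_mul_apply, mul_swapOp_apply]
  simp only [onFactor_mul_onFactor_apply hab, onFactor_mul_onFactor_apply hab.symm,
    Set.pair_comm b a, hI, hJ, Function.comp_apply, Equiv.swap_apply_left,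
    Equiv.swap_apply_right]
  split_ifs
  · exact h _ _ _ _
  · simp only [smul_zero, add_zero]

end SwapOperators

/-! ### The `R`-matrix -/

section RMatrix

variable {T ι κ K : Type*} [Ring T] {n : ℕ} [Fintype ι] [DecidableEq ι] [Fintype κ] [DecidableEq κ]
  [CommRing K] [Algebra K T]

/-- Diagonal coefficients of `q (u - v) R(u/v)`. -/
def rDiag (q u v : K) (i j : Fin n) : K := if i = j then q ^ 2 * u - v else q * (u - v)

/-- Permuting coefficients of `q (u - v) R(u/v)`. -/
def rPerm (q u v : K) (i j : Fin n) : K :=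
  if i < j then (q ^ 2 - 1) * u else if j < i then (q ^ 2 - 1) * v else 0

/-- The operator `q (u - v) R(u/v)` acting in the tensor factors `a` and `b`; the factor
`q (u - v)` makes it polynomial in `q`, `u` and `v`. -/
def rOp (T : Type*) [Ring T] [Algebra K T] (n : ℕ) (q : K) (a b : ι) (u v : K) :
    Matrix (ι → Fin n) (ι → Fin n) T :=
  swapOp T a b (rDiag q u v) (rPerm q u v)

theorem rOp_mul_apply (q : K) (a b : ι) (u v : K) (X : Matrix (ι → Fin n) (ι → Fin n) T)
    (I J : ι → Fin n) :
    (rOp T n q a b u v * X) I J = rDiag q u v (I a) (I b) • X I J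
      + rPerm q u v (I a) (I b) • X (I ∘ Equiv.swap a b) J :=
  swapOp_mul_apply _ _ _ _ _ _ _

theorem yang_baxter_coeff {V : Type*} [AddCommGroup V] [Module K V] (q u v w : K)
    (F : Fin n → Fin n → Fin n → V) (i j k : Fin n) :
    rDiag q u v i j • (rDiag q u w i k • (rDiag q v w j k • F i j k + rPerm q v w j k • F i k j)
        + rPerm q u w i k • (rDiag q v w j i • F k j i + rPerm q v w j i • F k i j))
      + rPerm q u v i j • (rDiag q u w j k • (rDiag q v w i k • F j i k + rPerm q v w i k • F j k i)
        + rPerm q u w j k • (rDiag q v w i j • F k i j + rPerm q v w i j • F k j i))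
    = rDiag q v w j k • (rDiag q u w i k • (rDiag q u v i j • F i j k + rPerm q u v i j • F j i k)
        + rPerm q u w i k • (rDiag q u v k j • F k j i + rPerm q u v k j • F j k i))
      + rPerm q v w j k • (rDiag q u w i j • (rDiag q u v i k • F i k j + rPerm q u v i k • F k i j)
        + rPerm q u w i j • (rDiag q u v j k • F j k i + rPerm q u v j k • F k j i)) := by
  simp only [rDiag, rPerm]
  rcases lt_trichotomy i j with hij | hij | hij <;>
    rcases lt_trichotomy j k with hjk | hjk | hjk <;>
    rcases lt_trichotomy i k with hik | hik | hik <;> first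
    | (exfalso; omega)
    | (subst_vars
       simp only [*, lt_irrefl, ne_of_lt, ne_of_gt, not_lt_of_gt, if_true, if_false]
       module)

theorem rOp_yang_baxter (q u v w : K) {a b c : ι} (hab : a ≠ b) (hac : a ≠ c) (hbc : b ≠ c) :
    SemiconjBy (rOp T n q a b u v) (rOp T n q a c u w * rOp T n q b c v w)
      (rOp T n q b c v w * rOp T n q a c u w) := by
  have h01 : ∀ i j k : Fin n, ![i, j, k] ∘ Equiv.swap 0 1 = ![j, i, k] := fun i j k => by
    ext r; fin_cases r <;> rfl
  have h02 : ∀ i j k : Fin n, ![i, j, k] ∘ Equiv.swap 0 2 = ![k, j, i] := fun i j k => by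
    ext r; fin_cases r <;> rfl
  have h12 : ∀ i j k : Fin n, ![i, j, k] ∘ Equiv.swap 1 2 = ![i, k, j] := fun i j k => by
    ext r; fin_cases r <;> rfl
  have three : SemiconjBy (rOp T n q (0 : Fin 3) 1 u v) (rOp T n q 0 2 u w * rOp T n q 1 2 v w)
      (rOp T n q 1 2 v w * rOp T n q 0 2 u w) := by
    suffices h : ∀ X, rOp T n q (0 : Fin 3) 1 u v * (rOp T n q 0 2 u w * (rOp T n q 1 2 v w * X))
        = rOp T n q 1 2 v w * (rOp T n q 0 2 u w * (rOp T n q 0 1 u v * X)) by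
      simpa [SemiconjBy, mul_assoc] using h 1
    intro X
    ext I J
    obtain ⟨i, j, k, rfl⟩ : ∃ i j k, I = ![i, j, k] :=
      ⟨I 0, I 1, I 2, by ext r; fin_cases r <;> rfl⟩
    simp only [rOp_mul_apply, h01, h02, h12]
    exact yang_baxter_coeff q u v w (fun i j k => X ![i, j, k] J) i j k
  let e : Fin 3 ↪ ι := ⟨![a, b, c], by
    simp [Function.Injective, Fin.forall_fin_succ, hab, hac, hbc, hab.symm, hac.symm, hbc.symm]⟩
  have h := three.map (onFactors e)
  simp only [rOp, map_mul, onFactors_swapOp] at h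
  exact h

theorem rOp_mul_rOp_swap (q u v : K) (a b : ι) :
    rOp T n q a b u v * rOp T n q b a v u = ((q ^ 2 * u - v) * (q ^ 2 * v - u)) • 1 := by
  suffices h : ∀ X, rOp T n q a b u v * (rOp T n q b a v u * X)
      = ((q ^ 2 * u - v) * (q ^ 2 * v - u)) • X by
    simpa using h 1
  intro X
  ext I J
  simp only [rOp_mul_apply, Equiv.swap_comm b a, comp_swap_comp_swap, Function.comp_apply,
    Equiv.swap_apply_left, Equiv.swap_apply_right, Matrix.smul_apply, rDiag, rPerm]
  rcases lt_trichotomy (I a) (I b) with h | h | h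
  · simp only [h, h.ne, h.ne', h.not_gt, if_true, if_false]
    module
  · simp only [h, lt_irrefl, if_true, if_false]
    module
  · simp only [h, h.ne, h.ne', h.not_gt, if_true, if_false]
    module

theorem isUnit_rOp {q u v : K} (huv : IsUnit (q ^ 2 * u - v)) (hvu : IsUnit (q ^ 2 * v - u))
    (a b : ι) : IsUnit (rOp T n q a b u v) := by
  obtain ⟨c, hc⟩ := huv.mul hvu
  refine isUnit_iff_exists.2 ⟨(↑c⁻¹ : K) • rOp T n q b a v u, ?_, ?_⟩
  · rw [mul_smul_comm, rOp_mul_rOp_swap, ← hc, smul_smul, Units.inv_mul, one_smul]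
  · rw [smul_mul_assoc, rOp_mul_rOp_swap, mul_comm, ← hc, smul_smul, Units.inv_mul, one_smul]

variable [Algebra ℂ T]

/-- The `q`-permutation `e_i ⊗ e_j ↦ q^{-sgn(i-j)} e_j ⊗ e_i` of the tensor factors `a` and `b`. -/
def pOp (T : Type*) [Ring T] [Algebra ℂ T] (n : ℕ) (q : ℂ) (a b : ι) :
    Matrix (ι → Fin n) (ι → Fin n) T :=
  swapOp T a b (fun _ _ => (0 : ℂ)) fun i j => q ^ Int.sign ((i : ℤ) - (j : ℤ))

theorem pOp_mul_apply (q : ℂ) (a b : ι) (X : Matrix (ι → Fin n) (ι → Fin n) T)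
    (I J : ι → Fin n) :
    (pOp T n q a b * X) I J
      = q ^ Int.sign ((I a : ℤ) - (I b : ℤ)) • X (I ∘ Equiv.swap a b) J := by
  rw [pOp, swapOp_mul_apply, zero_smul, zero_add]

theorem zpow_sign_sub (q : ℂ) (i j : Fin n) :
    q ^ Int.sign ((i : ℤ) - (j : ℤ)) = if i < j then q⁻¹ else if j < i then q else 1 := by
  split_ifs with hij hji
  · rw [Int.sign_eq_neg_one_of_neg (by omega), zpow_neg_one]
  · rw [Int.sign_eq_one_of_pos (by omega), zpow_one]
  · rw [show i = j by omega, sub_self, Int.sign_zero, zpow_zero]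

theorem rOp_sq_mul [Algebra ℂ K] [IsScalarTower ℂ K T] {q : ℂ} (hq : q ≠ 0) (a b : ι) (u : K) :
    rOp T n (algebraMap ℂ K q) a b u (algebraMap ℂ K q ^ 2 * u)
      = (u * algebraMap ℂ K (q * (1 - q ^ 2))) • (1 - pOp T n q a b) := by
  suffices h : ∀ X, rOp T n (algebraMap ℂ K q) a b u (algebraMap ℂ K q ^ 2 * u) * X
      = (u * algebraMap ℂ K (q * (1 - q ^ 2))) • (X - pOp T n q a b * X) by
    simpa using h 1
  intro X
  ext I J
  have smul_eq : ∀ (c : ℂ) (x : T), c • x = algebraMap ℂ K c • x :=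
    fun c x => (algebraMap_smul K c x).symm
  have inv_eq : algebraMap ℂ K q * algebraMap ℂ K q⁻¹ = 1 := by
    rw [← map_mul, mul_inv_cancel₀ hq, map_one]
  have coeff_eq : u * (algebraMap ℂ K q * (1 - algebraMap ℂ K q ^ 2)) * algebraMap ℂ K q⁻¹
      = u * (1 - algebraMap ℂ K q ^ 2) := by
    linear_combination u * (1 - algebraMap ℂ K q ^ 2) * inv_eq
  simp only [rOp_mul_apply, Matrix.smul_apply, Matrix.sub_apply, pOp_mul_apply, rDiag, rPerm,
    zpow_sign_sub, smul_eq, smul_sub, smul_smul, map_mul, map_sub, map_one, map_pow]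
  rcases lt_trichotomy (I a) (I b) with h | h | h
  · simp only [h, h.ne, coeff_eq, if_true, if_false]
    module
  · simp only [h, comp_swap_of_eq h, lt_irrefl, map_one, if_true, if_false]
    module
  · simp only [h, h.ne', h.not_gt, if_true, if_false]
    module

end RMatrix

/-! ### Antisymmetrizers and ordered products -/

section Semiconj

variable {A : Type*} [Ring A]

/-- The elements `x` that can be moved through `p` from the right to the left, turning into an
element of `S`. -/
def semiconjSubmonoid (p : A) (S : Submonoid A) : Submonoid A where
  carrier := {x | ∃ y ∈ S, SemiconjBy p x y}
  one_mem' := ⟨1, S.one_mem, SemiconjBy.one_right p⟩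
  mul_mem' := fun ⟨_, hy, h⟩ ⟨_, hy', h'⟩ => ⟨_, S.mul_mem hy hy', h.mul_right h'⟩

theorem mem_semiconjSubmonoid_of_commute {p x : A} {S : Submonoid A} (h : Commute p x)
    (hx : x ∈ S) : x ∈ semiconjSubmonoid p S :=
  ⟨x, hx, h⟩

theorem semiconjSubmonoid_le_top (p : A) (S : Submonoid A) :
    semiconjSubmonoid p S ≤ semiconjSubmonoid p ⊤ :=
  fun _ ⟨y, _, h⟩ => ⟨y, Submonoid.mem_top y, h⟩

theorem inv_mem_semiconjSubmonoid {p : A} {x : Aˣ}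
    (h : (x : A) ∈ semiconjSubmonoid p (IsUnit.submonoid A)) :
    ((x⁻¹ : Aˣ) : A) ∈ semiconjSubmonoid p (IsUnit.submonoid A) := by
  obtain ⟨_, ⟨y, rfl⟩, h⟩ := h
  exact ⟨_, ⟨y⁻¹, rfl⟩, h.units_inv_right⟩

end Semiconj

section Antisymmetrizer

variable {A : Type*} [Ring A] {k : ℕ}

theorem mul_eq_sign_smul_of_adjacent (ρ : Equiv.Perm (Fin k) →* A) {Y : A}
    (h : ∀ a b : Fin k, (b : ℕ) = a + 1 → Y * ρ (Equiv.swap a b) = -Y) (σ : Equiv.Perm (Fin k)) :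
    Y * ρ σ = Equiv.Perm.sign σ • Y := by
  cases k with
  | zero => rw [Subsingleton.elim σ 1, map_one, map_one, mul_one, one_smul]
  | succ k =>
    have hσ : σ ∈ Submonoid.closure (range fun i : Fin k => Equiv.swap i.castSucc i.succ) := by
      rw [Equiv.Perm.mclosure_swap_castSucc_succ]
      trivial
    induction hσ using Submonoid.closure_induction with
    | mem x hx =>
      obtain ⟨i, rfl⟩ := hx
      rw [h _ _ (by simp), Equiv.Perm.sign_swap (by simp [Fin.ext_iff]), Units.neg_smul, one_smul]
    | one => rw [map_one, map_one, mul_one, one_smul]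
    | mul x y _ _ hx hy => rw [map_mul, map_mul, ← mul_assoc, hx, smul_mul_assoc, hy, smul_smul]

variable [Algebra ℂ A]

/-- The image of the antisymmetrizer `(1/k!) ∑_τ (-1)^τ τ` under a representation of the symmetric
group. -/
def antisymmetrizer (ρ : Equiv.Perm (Fin k) →* A) : A :=
  (k.factorial : ℂ)⁻¹ • ∑ τ, Equiv.Perm.sign τ • ρ τ

theorem antisymmetrizer_mul (ρ : Equiv.Perm (Fin k) →* A) (σ : Equiv.Perm (Fin k)) :
    antisymmetrizer ρ * ρ σ = Equiv.Perm.sign σ • antisymmetrizer ρ := by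
  rw [antisymmetrizer, smul_mul_assoc, Finset.sum_mul, smul_comm (Equiv.Perm.sign σ),
    Finset.smul_sum (r := Equiv.Perm.sign σ)]
  refine congrArg _ (Fintype.sum_equiv (Equiv.mulRight σ) _ _ fun τ => ?_)
  rw [Equiv.coe_mulRight, map_mul, map_mul, smul_mul_assoc, smul_smul, mul_comm, mul_assoc,
    Int.units_mul_self, mul_one]

theorem mul_antisymmetrizer (ρ : Equiv.Perm (Fin k) →* A) (σ : Equiv.Perm (Fin k)) :
    ρ σ * antisymmetrizer ρ = Equiv.Perm.sign σ • antisymmetrizer ρ := by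
  rw [antisymmetrizer, mul_smul_comm, Finset.mul_sum, smul_comm (Equiv.Perm.sign σ),
    Finset.smul_sum (r := Equiv.Perm.sign σ)]
  refine congrArg _ (Fintype.sum_equiv (Equiv.mulLeft σ) _ _ fun τ => ?_)
  rw [Equiv.coe_mulLeft, map_mul, map_mul, mul_smul_comm, smul_smul, ← mul_assoc,
    Int.units_mul_self, one_mul]

theorem mul_antisymmetrizer_of_sign (ρ : Equiv.Perm (Fin k) →* A) {Y : A}
    (h : ∀ σ, Y * ρ σ = Equiv.Perm.sign σ • Y) : Y * antisymmetrizer ρ = Y := by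
  have hsum : ∑ τ : Equiv.Perm (Fin k), Y * Equiv.Perm.sign τ • ρ τ = (k.factorial : ℂ) • Y := by
    simp only [mul_smul_comm, h, smul_smul, Int.units_mul_self, one_smul, Finset.sum_const,
      Finset.card_univ, Fintype.card_perm, Fintype.card_fin, Nat.cast_smul_eq_nsmul]
  rw [antisymmetrizer, mul_smul_comm, Finset.mul_sum, hsum,
    inv_smul_smul₀ (Nat.cast_ne_zero.2 k.factorial_ne_zero)]

theorem antisymmetrizer_mul_self (ρ : Equiv.Perm (Fin k) →* A) :
    antisymmetrizer ρ * antisymmetrizer ρ = antisymmetrizer ρ :=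
  mul_antisymmetrizer_of_sign ρ (antisymmetrizer_mul ρ)

theorem antisymmetrizer_mul_mul_antisymmetrizer (ρ : Equiv.Perm (Fin k) →* A) {X : A}
    (h : ∀ a b : Fin k, (b : ℕ) = a + 1 → X ∈ semiconjSubmonoid (1 - ρ (Equiv.swap a b)) ⊤) :
    antisymmetrizer ρ * X * antisymmetrizer ρ = antisymmetrizer ρ * X := by
  refine mul_antisymmetrizer_of_sign ρ (mul_eq_sign_smul_of_adjacent ρ fun a b hab => ?_)
  set s := ρ (Equiv.swap a b)
  obtain ⟨y, -, hy⟩ := h a b hab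
  have hs : s * s = 1 := by rw [← map_mul, Equiv.swap_mul_self, map_one]
  have kill : (1 - s) * X * (1 + s) = 0 := by
    rw [hy.eq, mul_assoc, show (1 - s) * (1 + s) = 1 - s * s by noncomm_ring, hs, sub_self,
      mul_zero]
  have absorb : antisymmetrizer ρ * (1 - s) = (2 : ℂ) • antisymmetrizer ρ := by
    rw [mul_sub, antisymmetrizer_mul, Equiv.Perm.sign_swap (by rintro rfl; omega), Units.neg_smul,
      one_smul, mul_one, sub_neg_eq_add, two_smul]
  have two_smul_eq : (2 : ℂ) • (antisymmetrizer ρ * X * (1 + s)) = 0 := by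
    rw [← smul_mul_assoc, ← smul_mul_assoc, ← absorb, mul_assoc _ (1 - s), mul_assoc, kill,
      mul_zero]
  rw [smul_eq_zero_iff_right two_ne_zero, mul_add, mul_one] at two_smul_eq
  exact eq_neg_of_add_eq_zero_right two_smul_eq

end Antisymmetrizer

section OrderedProducts

variable {A : Type*} [Ring A]

theorem commute_list_map_prod {β : Type*} {x : A} {f : β → A} {l : List β}
    (h : ∀ b ∈ l, Commute x (f b)) : Commute x (l.map f).prod :=
  Commute.list_prod_right _ _ (List.forall_mem_map.2 h)

theorem semiconjBy_list_map_prod {β : Type*} {x : A} {f g : β → A} {l : List β}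
    (h : ∀ b ∈ l, SemiconjBy x (f b) (g b)) : SemiconjBy x (l.map f).prod (l.map g).prod := by
  induction l with
  | nil => exact SemiconjBy.one_right x
  | cons b l ih =>
    rw [List.forall_mem_cons] at h
    simp only [List.map_cons, List.prod_cons]
    exact h.1.mul_right (ih h.2)

theorem list_prod_mul_list_prod {β : Type*} {f g : β → A} {l : List β}
    (hc : l.Pairwise fun b c => Commute (f c) (g b)) :
    (l.map f).prod * (l.map g).prod = (l.map fun b => f b * g b).prod := by
  induction hc with
  | nil => simp
  | @cons b l hb _ ih =>
    simp only [List.map_cons, List.prod_cons]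
    rw [← ih, mul_assoc, ← mul_assoc _ (g b),
      ← (commute_list_map_prod fun c hc => (hb c hc).symm).eq]
    simp only [mul_assoc]

theorem exchange_list_prod {β : Type*} {m : A} {r x : β → A} {l : List β}
    (h : ∀ b ∈ l, r b * m * x b = x b * m * r b)
    (hc : l.Pairwise fun b c => Commute (r b) (x c) ∧ Commute (r c) (x b)) :
    (l.map r).reverse.prod * m * (l.map x).prod = (l.map x).prod * m * (l.map r).reverse.prod := by
  induction hc with
  | nil => simp
  | @cons b l hb _ ih =>
    rw [List.forall_mem_cons] at h
    have hx : Commute (l.map r).reverse.prod (x b) := by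
      rw [← List.map_reverse]
      exact (commute_list_map_prod fun c hc => (hb c (List.mem_reverse.1 hc)).2.symm).symm
    have hr : Commute (r b) (l.map x).prod := commute_list_map_prod fun c hc => (hb c hc).1
    simp only [List.map_cons, List.reverse_cons, List.prod_append, List.prod_cons, List.prod_nil,
      mul_one]
    calc (l.map r).reverse.prod * r b * m * (x b * (l.map x).prod)
        = (l.map r).reverse.prod * (r b * m * x b) * (l.map x).prod := by noncomm_ring
      _ = (l.map r).reverse.prod * x b * m * (r b * (l.map x).prod) := by
          rw [h.1]; noncomm_ring
      _ = x b * ((l.map r).reverse.prod * m * (l.map x).prod) * r b := by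
          rw [hx.eq, hr.eq]; noncomm_ring
      _ = _ := by rw [ih h.2]; noncomm_ring

theorem finRange_eq_append {k : ℕ} {a b : Fin k} (hab : (b : ℕ) = a + 1) :
    ∃ l₁ l₂ : List (Fin k), List.finRange k = l₁ ++ a :: b :: l₂ ∧
      ∀ c ∈ l₁ ++ l₂, c ≠ a ∧ c ≠ b := by
  have h : List.finRange k
      = (List.finRange k).take a ++ a :: b :: (List.finRange k).drop (a + 2) := by
    conv_lhs => rw [← List.take_append_drop a (List.finRange k),
      List.drop_eq_getElem_cons (by simp), List.drop_eq_getElem_cons (by simp; omega)]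
    simp [Fin.ext_iff, hab]
  refine ⟨_, _, h, fun c hc => ?_⟩
  have hn := List.nodup_finRange k
  rw [h] at hn
  grind

theorem list_prod_finRange_mem {k : ℕ} {f : Fin k → A} {M : Submonoid A} {a b : Fin k}
    (hab : (b : ℕ) = a + 1) (hf : ∀ c, c ≠ a → c ≠ b → f c ∈ M) (h : f a * f b ∈ M) :
    ((List.finRange k).map f).prod ∈ M := by
  obtain ⟨l₁, l₂, hl, hne⟩ := finRange_eq_append hab
  have outer : ∀ l ⊆ l₁ ++ l₂, (l.map f).prod ∈ M := fun l hl =>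
    M.list_prod_mem (List.forall_mem_map.2 fun c hc => hf c (hne c (hl hc)).1 (hne c (hl hc)).2)
  rw [hl, List.map_append, List.prod_append, List.map_cons, List.map_cons, List.prod_cons,
    List.prod_cons, ← mul_assoc (f a)]
  exact M.mul_mem (outer _ (List.subset_append_left _ _))
    (M.mul_mem h (outer _ (List.subset_append_right _ _)))

theorem list_prod_finRange_reverse_mem {k : ℕ} {f : Fin k → A} {M : Submonoid A} {a b : Fin k}
    (hab : (b : ℕ) = a + 1) (hf : ∀ c, c ≠ a → c ≠ b → f c ∈ M) (h : f b * f a ∈ M) :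
    ((List.finRange k).map f).reverse.prod ∈ M := by
  rw [← List.map_reverse, List.finRange_reverse, List.map_map]
  refine list_prod_finRange_mem (a := b.rev) (b := a.rev) (by grind) (fun c hb ha => ?_) ?_
  · exact hf _ (fun h => ha (by rw [← h, Fin.rev_rev])) fun h => hb (by rw [← h, Fin.rev_rev])
  · simpa using h

end OrderedProducts

/-! ### Traces and the `q`-permutation representation -/

section Trace

variable {T I : Type*} [Ring T] [Fintype I] [DecidableEq I]

theorem trace_mul_comm_of_mem_matrix_center {X : Matrix I I T} (hX : X ∈ (Subring.center T).matrix)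
    (Y : Matrix I I T) : (X * Y).trace = (Y * X).trace := by
  simp only [Matrix.trace, Matrix.diag_apply, Matrix.mul_apply]
  rw [Finset.sum_comm]
  simp only [Subring.mem_center_iff.1 (hX _ _)]

theorem trace_mul_eq_of_intertwiner {a x y : Matrix I I T} {r : (Matrix I I T)ˣ}
    (ha : a * a = a) (hc : a * (r : Matrix I I T) ∈ (Subring.center T).matrix)
    (hr : a * r * a = a * r) (hri : a * (r⁻¹).val * a = a * (r⁻¹).val) (hy : a * y * a = a * y)
    (h : SemiconjBy (r : Matrix I I T) x y) : (a * x).trace = (a * y).trace := by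
  have hx : a * x = a * (r⁻¹).val * a * y * (a * r) := by
    calc a * x = a * (r⁻¹).val * (r * x) := by rw [mul_assoc, Units.inv_mul_cancel_left]
      _ = a * (r⁻¹).val * a * (y * r) := by rw [h.eq, hri]
      _ = a * (r⁻¹).val * (a * y) * r := by noncomm_ring
      _ = a * (r⁻¹).val * (a * y * a) * r := by rw [hy]
      _ = a * (r⁻¹).val * a * y * (a * r) := by noncomm_ring
  have hy' : a * r * (a * (r⁻¹).val * a * y) = a * y := by
    calc a * r * (a * (r⁻¹).val * a * y) = a * r * a * (r⁻¹).val * (a * y) := by noncomm_ring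
      _ = a * (r * (r⁻¹).val) * (a * y) := by rw [hr]; noncomm_ring
      _ = a * a * y := by rw [Units.mul_inv]; noncomm_ring
      _ = a * y := by rw [ha]
  rw [hx, ← trace_mul_comm_of_mem_matrix_center hc, hy']

end Trace

theorem trace_onFactors_mul_onFactors {T α ι κ κ' : Type*} [Ring T] [Fintype α] [DecidableEq α]
    [Fintype ι] [DecidableEq ι] [Fintype κ] [DecidableEq κ] [Fintype κ'] [DecidableEq κ']
    {e : κ ↪ ι} {e' : κ' ↪ ι} (h : (Sum.elim e e').Bijective)
    (X : Matrix (κ → α) (κ → α) T) (Y : Matrix (κ' → α) (κ' → α) T) :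
    (onFactors e X * onFactors e' Y).trace = X.trace * Y.trace := by
  have hd : Disjoint (range e) (range e') := by
    rw [Set.disjoint_range_iff]
    exact fun a b hab => Sum.inl_ne_inr (h.1 hab)
  have hu : (range e ∪ range e')ᶜ = ∅ := by
    rw [← Set.Sum.elim_range, h.2.range_eq, Set.compl_univ]
  simp only [Matrix.trace, Matrix.diag_apply, onFactors_mul_onFactors_apply hd, hu,
    Set.eqOn_empty, if_true]
  rw [Finset.sum_mul_sum, ← Fintype.sum_prod_type']
  exact Fintype.sum_equiv
    (((Equiv.ofBijective _ h).symm.arrowCongr (Equiv.refl α)).trans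
      (Equiv.sumArrowEquivProdArrow κ κ' α)) _ _ fun I => rfl

section Representation

variable {T ι κ : Type*} [Ring T] {n k l : ℕ} [Fintype ι] [DecidableEq ι]
  [Fintype κ] [DecidableEq κ] {q : ℂ}

theorem onFactors_mem_matrix_center (e : κ ↪ ι) {X : Matrix (κ → Fin n) (κ → Fin n) T}
    (hX : X ∈ (Subring.center T).matrix) : onFactors e X ∈ (Subring.center T).matrix := by
  intro I J
  rw [onFactors_apply]
  split_ifs
  · exact hX _ _
  · exact zero_mem _

/-- `M₀^{(1)} ⋯ M_{k-1}^{(k)}` in the tensor factors labelled by `e`. -/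
def legProd (e : Fin k ↪ ι) (M : ℕ → Matrix (Fin n) (Fin n) T) :
    Matrix (ι → Fin n) (ι → Fin n) T :=
  ((List.finRange k).map fun s => onFactor (e s) (M s)).prod

theorem onFactors_legProd (e : κ ↪ ι) (e' : Fin k ↪ κ) (M : ℕ → Matrix (Fin n) (Fin n) T) :
    onFactors e (legProd e' M) = legProd (e'.trans e) M := by
  rw [legProd, legProd, map_list_prod, List.map_map]
  exact congrArg _ (List.map_congr_left fun s _ => onFactors_onFactor e (e' s) (M s))

variable [Algebra ℂ T]

theorem map_antisymmetrizer {A B : Type*} [Ring A] [Algebra ℂ A] [Ring B] [Algebra ℂ B]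
    (φ : A →ₐ[ℂ] B) (ρ : Equiv.Perm (Fin k) →* A) :
    φ (antisymmetrizer ρ) = antisymmetrizer ((φ : A →* B).comp ρ) := by
  simp only [antisymmetrizer, map_smul, map_sum, Units.smul_def, map_zsmul]
  rfl

/-- `π_q` as a homomorphism. -/
def qPermHom (n k : ℕ) (hq : q ≠ 0) :
    Equiv.Perm (Fin k) →* Matrix (Fin k → Fin n) (Fin k → Fin n) ℂ where
  toFun := qPerm n q
  map_one' := by
    have h : ∀ J : Fin k → Fin n, permWeight q 1 J = 1 := fun J =>
      Finset.prod_eq_one fun a _ => Finset.prod_eq_one fun b _ => if_neg fun h => h.1.not_gt h.2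
    ext I J
    simp only [qPerm, Matrix.of_apply, h, Matrix.one_apply]
    rfl
  map_mul' := qPerm_mul n hq

theorem qAntisymm_eq_antisymmetrizer (hq : q ≠ 0) :
    qAntisymm n k q = antisymmetrizer (qPermHom n k hq) := by
  simp only [qAntisymm, antisymmetrizer, Units.smul_def, Int.cast_smul_eq_zsmul]
  rfl

/-- A complex matrix acting in the tensor factors labelled by the range of `e`. -/
def onFactorsScalar (T : Type*) [Ring T] [Algebra ℂ T] (n : ℕ) (e : κ ↪ ι) :
    Matrix (κ → Fin n) (κ → Fin n) ℂ →ₐ[ℂ] Matrix (ι → Fin n) (ι → Fin n) T :=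
  (AlgHom.mk' (onFactors e) (onFactors_smul e)).comp (Algebra.ofId ℂ T).mapMatrix

theorem onFactorsScalar_apply (e : κ ↪ ι) (X : Matrix (κ → Fin n) (κ → Fin n) ℂ) :
    onFactorsScalar T n e X = onFactors e (scalar T X) :=
  rfl

/-- The representation `π_q` acting in the tensor factors labelled by the range of `e`. -/
def repOp (T : Type*) [Ring T] [Algebra ℂ T] (n : ℕ) (hq : q ≠ 0) (e : Fin k ↪ ι) :
    Equiv.Perm (Fin k) →* Matrix (ι → Fin n) (ι → Fin n) T :=
  (onFactorsScalar T n e : _ →* _).comp (qPermHom n k hq)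

theorem onFactors_scalar_qAntisymm (hq : q ≠ 0) (e : Fin k ↪ ι) :
    onFactors e (scalar T (qAntisymm n k q)) = antisymmetrizer (repOp T n hq e) := by
  rw [← onFactorsScalar_apply, qAntisymm_eq_antisymmetrizer hq, map_antisymmetrizer]
  rfl

theorem repOp_swap (hq : q ≠ 0) (e : Fin k ↪ ι) {a b : Fin k} (hab : (b : ℕ) = a + 1) :
    repOp T n hq e (Equiv.swap a b) = pOp T n q (e a) (e b) := by
  suffices h : scalar T (qPerm n q (Equiv.swap a b)) = pOp T n q a b by
    rw [pOp, ← onFactors_swapOp e a b, ← pOp, ← h]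
    rfl
  ext I J
  simp only [scalar, Matrix.map_apply, qPerm_swap n q a b hab, pOp, swapOp, Matrix.of_apply,
    map_zero, ite_self, zero_add, eq_comp_swap_iff a b I J]
  split_ifs with h
  · rw [h, Function.comp_apply, Function.comp_apply, Equiv.swap_apply_left, Equiv.swap_apply_right,
      ← Int.sign_neg, neg_sub]
  · exact map_zero _

theorem scalar_mem_matrix_center {I : Type*} [Fintype I] [DecidableEq I] (X : Matrix I I ℂ) :
    scalar T X ∈ (Subring.center T).matrix :=
  fun _ _ => Subring.mem_center_iff.2 fun t => (Algebra.commutes _ t).symm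

theorem antisymmTrace_eq (q : ℂ) (M : ℕ → Matrix (Fin n) (Fin n) T) (k : ℕ) :
    antisymmTrace q M k
      = (scalar T (qAntisymm n k q) * legProd (Function.Embedding.refl (Fin k)) M).trace := by
  simp only [antisymmTrace, legProd, List.ofFn_eq_map, leg_eq_onFactor,
    Function.Embedding.refl_apply]

theorem antisymmTrace_mul_antisymmTrace (hq : q ≠ 0) {e : Fin k ↪ ι} {e' : Fin l ↪ ι}
    (h : (Sum.elim e e').Bijective) (M N : ℕ → Matrix (Fin n) (Fin n) T) :
    antisymmTrace q M k * antisymmTrace q N l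
      = (antisymmetrizer (repOp T n hq e) * antisymmetrizer (repOp T n hq e')
          * (legProd e M * legProd e' N)).trace := by
  have hd : Disjoint (range e') (range e) := by
    rw [Set.disjoint_range_iff]
    exact fun b a hab => Sum.inr_ne_inl (h.1 hab)
  rw [antisymmTrace_eq, antisymmTrace_eq, ← trace_onFactors_mul_onFactors h, map_mul, map_mul,
    (onFactors_commute_onFactors hd (scalar_mem_matrix_center _) _).symm.mul_mul_mul_comm,
    onFactors_scalar_qAntisymm hq, onFactors_scalar_qAntisymm hq, onFactors_legProd,
    onFactors_legProd]
  rfl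

end Representation

/-! ### Transfer functions commute -/

section Transfer

variable {T ι K : Type*} [Ring T] {n k l : ℕ} [CommRing K] [Algebra K T]

/-- The `RLL` relation, with the `R`-matrix at the quotient of the spectral parameters `u`, `v`. -/
abbrev RLL (Q u v : K) (A B : Matrix (Fin n) (Fin n) T) : Prop :=
  ExchangeRel (rDiag Q u v) (rPerm Q u v) A B

theorem rll_self {Q : K} (hQ : Q ^ 2 = 1) (u : K) (A B : Matrix (Fin n) (Fin n) T) :
    RLL Q u u A B := by
  intro i j r s
  simp only [rDiag, rPerm, hQ, one_mul, sub_self, mul_zero, zero_mul, ite_self, zero_smul, add_zero]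

/-- A sequence of matrices whose spectral parameters form a geometric progression of ratio `Q²`, so
that the `R`-matrices of neighbouring members degenerate. -/
structure IsRLLString (Q : K) (k : ℕ) (u : ℕ → K) (M : ℕ → Matrix (Fin n) (Fin n) T) : Prop where
  isUnit : ∀ i < k, IsUnit (u i)
  succ : ∀ i, i + 1 < k → u (i + 1) = Q ^ 2 * u i
  rll : ∀ i, i + 1 < k → RLL Q (u i) (u (i + 1)) (M i) (M (i + 1))

theorem IsRLLString.shift {Q : K} {u : ℕ → K} {M : ℕ → Matrix (Fin n) (Fin n) T}
    (h : IsRLLString Q k u M) {s i : ℕ} (hs : s + i ≤ k) :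
    IsRLLString Q i (fun a => u (s + a)) fun a => M (s + a) where
  isUnit a ha := h.isUnit _ (by omega)
  succ a ha := h.succ (s + a) (by omega)
  rll a ha := h.rll (s + a) (by omega)

/-- Two sequences of matrices whose members satisfy the `RLL` relation with one another, with
invertible `R`-matrices. -/
structure IsRLLPair (Q : K) (k l : ℕ) (u v : ℕ → K) (M N : ℕ → Matrix (Fin n) (Fin n) T) :
    Prop where
  isUnit_left : ∀ i < k, ∀ j < l, IsUnit (Q ^ 2 * u i - v j)
  isUnit_right : ∀ i < k, ∀ j < l, IsUnit (Q ^ 2 * v j - u i)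
  rll : ∀ i < k, ∀ j < l, RLL Q (u i) (v j) (M i) (N j)

theorem IsRLLPair.shift {Q : K} {u v : ℕ → K} {M N : ℕ → Matrix (Fin n) (Fin n) T}
    (h : IsRLLPair Q k l u v M N) {s i s' j : ℕ} (hs : s + i ≤ k) (hs' : s' + j ≤ l) :
    IsRLLPair Q i j (fun a => u (s + a)) (fun b => v (s' + b)) (fun a => M (s + a))
      fun b => N (s' + b) where
  isUnit_left a ha b hb := h.isUnit_left _ (by omega) _ (by omega)
  isUnit_right a ha b hb := h.isUnit_right _ (by omega) _ (by omega)
  rll a ha b hb := h.rll _ (by omega) _ (by omega)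

variable [Fintype ι] [DecidableEq ι]

/-- `R(u/v_{l-1}) ⋯ R(u/v_0)` up to a scalar, with first leg `a` and second legs labelled by `e`. -/
def fusedRow (T : Type*) [Ring T] [Algebra K T] (n : ℕ) (Q : K) (a : ι) (e : Fin l ↪ ι) (u : K)
    (v : ℕ → K) : Matrix (ι → Fin n) (ι → Fin n) T :=
  ((List.finRange l).map fun b => rOp T n Q a (e b) u (v b)).reverse.prod

/-- The fused `R`-matrix, which exchanges a product of matrices in the tensor factors labelled by
`e` with a product in the tensor factors labelled by `e'`. -/
def fusedR (T : Type*) [Ring T] [Algebra K T] (n : ℕ) (Q : K) (e : Fin k ↪ ι) (e' : Fin l ↪ ι)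
    (u v : ℕ → K) : Matrix (ι → Fin n) (ι → Fin n) T :=
  ((List.finRange k).map fun a => fusedRow T n Q (e a) e' (u a) v).prod

section Fused

variable {Q : K} {u v : ℕ → K} {e : Fin k ↪ ι} {e' : Fin l ↪ ι}
  {M N : ℕ → Matrix (Fin n) (Fin n) T}

theorem IsRLLPair.isUnit_fusedRow (h : IsRLLPair Q k l u v M N) (a : Fin k) (r : ι)
    (e' : Fin l ↪ ι) : IsUnit (fusedRow T n Q r e' (u a) v) := by
  rw [fusedRow, ← List.map_reverse]
  exact (IsUnit.submonoid _).list_prod_mem (List.forall_mem_map.2 fun b _ =>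
    isUnit_rOp (h.isUnit_left a a.2 b b.2) (h.isUnit_right a a.2 b b.2) _ _)

theorem IsRLLPair.isUnit_fusedR (h : IsRLLPair Q k l u v M N) (e : Fin k ↪ ι) (e' : Fin l ↪ ι) :
    IsUnit (fusedR T n Q e e' u v) :=
  (IsUnit.submonoid _).list_prod_mem (List.forall_mem_map.2 fun a _ => h.isUnit_fusedRow a _ _)

theorem fusedR_mem_matrix_center (Q : K) (e : Fin k ↪ ι) (e' : Fin l ↪ ι) (u v : ℕ → K) :
    fusedR T n Q e e' u v ∈ (Subring.center T).matrix := by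
  refine list_prod_mem (List.forall_mem_map.2 fun a _ => ?_)
  rw [fusedRow, ← List.map_reverse]
  exact list_prod_mem (List.forall_mem_map.2 fun b _ => swapOp_mem_matrix_center _ _ _ _)

theorem fusedRow_commute_onFactor {a c : ι} (hac : a ≠ c) (ha : ∀ b, a ≠ e' b) (hc : ∀ b, c ≠ e' b)
    (u : K) (v : ℕ → K) (A : Matrix (Fin n) (Fin n) T) :
    Commute (fusedRow T n Q a e' u v) (onFactor c A) := by
  rw [fusedRow, ← List.map_reverse]
  exact (commute_list_map_prod fun b _ =>
    (swapOp_commute_onFactor (ha b) hac.symm (hc b) _ _ A).symm).symm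

theorem fusedRow_mul_onFactor_mul_legProd {a : ι} (ha : ∀ b, a ≠ e' b) {u : K}
    {A : Matrix (Fin n) (Fin n) T} (h : ∀ j < l, RLL Q u (v j) A (N j)) :
    fusedRow T n Q a e' u v * onFactor a A * legProd e' N
      = legProd e' N * onFactor a A * fusedRow T n Q a e' u v := by
  refine exchange_list_prod (fun b _ => ?_) ((List.nodup_finRange l).imp fun hbc => ⟨?_, ?_⟩)
  · rw [mul_assoc]
    exact ((h b b.2).semiconjBy_swapOp (ha b)).eq
  · exact swapOp_commute_onFactor (ha _) (ha _).symm (e'.injective.ne hbc.symm) _ _ _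
  · exact swapOp_commute_onFactor (ha _) (ha _).symm (e'.injective.ne hbc) _ _ _

theorem IsRLLPair.semiconjBy_fusedR (h : IsRLLPair Q k l u v M N) (hd : ∀ a b, e a ≠ e' b) :
    SemiconjBy (fusedR T n Q e e' u v) (legProd e M * legProd e' N)
      (legProd e' N * legProd e M) := by
  have hc : ∀ a c, a ≠ c → Commute (fusedRow T n Q (e a) e' (u a) v) (onFactor (e c) (M c)) :=
    fun a c hac => fusedRow_commute_onFactor (e.injective.ne hac) (hd a) (hd c) _ _ _
  have left : fusedR T n Q e e' u v * legProd e M = ((List.finRange k).map fun a =>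
      fusedRow T n Q (e a) e' (u a) v * onFactor (e a) (M a)).prod :=
    list_prod_mul_list_prod ((List.nodup_finRange k).imp fun hac => hc _ _ hac.symm)
  have right : legProd e M * fusedR T n Q e e' u v = ((List.finRange k).map fun a =>
      onFactor (e a) (M a) * fusedRow T n Q (e a) e' (u a) v).prod :=
    list_prod_mul_list_prod ((List.nodup_finRange k).imp fun hac => (hc _ _ hac).symm)
  rw [SemiconjBy, ← mul_assoc, left, mul_assoc, right]
  refine (semiconjBy_list_map_prod fun a _ => ?_).eq.symm
  rw [SemiconjBy, ← mul_assoc]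
  exact (fusedRow_mul_onFactor_mul_legProd (hd a) (h.rll a a.2)).symm

theorem fusedRow_mul_fusedRow {a b : ι} (hab : a ≠ b) (ha : ∀ c, a ≠ e' c) (hb : ∀ c, b ≠ e' c)
    (u u' : K) (v : ℕ → K) :
    fusedRow T n Q a e' u v * fusedRow T n Q b e' u' v
      = ((List.finRange l).reverse.map fun c =>
          rOp T n Q a (e' c) u (v c) * rOp T n Q b (e' c) u' (v c)).prod := by
  rw [fusedRow, fusedRow, ← List.map_reverse, ← List.map_reverse]
  exact list_prod_mul_list_prod ((List.nodup_reverse.2 (List.nodup_finRange l)).imp fun hcd =>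
    swapOp_commute_swapOp (ha _) (hb _) hab (ha _) (hb _).symm (e'.injective.ne hcd.symm) _ _ _ _)

end Fused

variable [Algebra ℂ T] {q : ℂ}

theorem pOp_commute_fusedRow {a b c : ι} {e' : Fin l ↪ ι} (hab : a ≠ b) (hac : a ≠ c) (hbc : b ≠ c)
    (ha : ∀ d, a ≠ e' d) (hb : ∀ d, b ≠ e' d) (hc : ∀ d, c ≠ e' d) (Q u : K) (v : ℕ → K) :
    Commute (pOp T n q a b) (fusedRow T n Q c e' u v) := by
  rw [fusedRow, ← List.map_reverse]
  exact commute_list_map_prod fun d _ =>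
    swapOp_commute_swapOp hab (hc d) hac (ha d) hbc (hb d) _ _ _ _

theorem mul_mul_mul_eq_of_commute {A : Type*} [Ring A] {a b x : A} (hab : Commute a b)
    (ha : a * x * a = a * x) (hb : b * x * b = b * x) : a * b * x * (a * b) = a * b * x := by
  calc a * b * x * (a * b) = b * (a * x * a) * b := by nth_rewrite 1 [hab.eq]; simp only [mul_assoc]
    _ = a * (b * x * b) := by rw [ha]; simp only [← mul_assoc, hab.eq]
    _ = a * b * x := by rw [hb, mul_assoc]

section Disjoint

variable (hq : q ≠ 0) {e : Fin k ↪ ι} {e' : Fin l ↪ ι} (hd : Disjoint (range e) (range e'))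
include hd

theorem antisymmetrizer_repOp_commute :
    Commute (antisymmetrizer (repOp T n hq e)) (antisymmetrizer (repOp T n hq e')) := by
  rw [← onFactors_scalar_qAntisymm, ← onFactors_scalar_qAntisymm]
  exact onFactors_commute_onFactors hd (scalar_mem_matrix_center _) _

theorem legProd_mem_semiconjSubmonoid_of_disjoint (N : ℕ → Matrix (Fin n) (Fin n) T)
    (σ : Equiv.Perm (Fin k)) : legProd e' N ∈ semiconjSubmonoid (1 - repOp T n hq e σ) ⊤ := by
  have h : Commute (repOp T n hq e σ) (onFactors e' (legProd (Function.Embedding.refl _) N)) :=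
    onFactors_commute_onFactors hd (scalar_mem_matrix_center _) _
  rw [onFactors_legProd] at h
  exact mem_semiconjSubmonoid_of_commute ((Commute.one_left _).sub_left h) trivial

theorem mul_antisymmetrizer_mul_antisymmetrizer {X : Matrix (ι → Fin n) (ι → Fin n) T}
    (h : ∀ a b : Fin k, (b : ℕ) = a + 1 →
      X ∈ semiconjSubmonoid (1 - repOp T n hq e (Equiv.swap a b)) ⊤)
    (h' : ∀ a b : Fin l, (b : ℕ) = a + 1 →
      X ∈ semiconjSubmonoid (1 - repOp T n hq e' (Equiv.swap a b)) ⊤) :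
    antisymmetrizer (repOp T n hq e) * antisymmetrizer (repOp T n hq e') * X
        * (antisymmetrizer (repOp T n hq e) * antisymmetrizer (repOp T n hq e'))
      = antisymmetrizer (repOp T n hq e) * antisymmetrizer (repOp T n hq e') * X :=
  mul_mul_mul_eq_of_commute (antisymmetrizer_repOp_commute hq hd)
    (antisymmetrizer_mul_mul_antisymmetrizer _ h) (antisymmetrizer_mul_mul_antisymmetrizer _ h')

end Disjoint

theorem antisymmetrizer_repOp_mem_matrix_center (hq : q ≠ 0) (e : Fin k ↪ ι) :
    antisymmetrizer (repOp T n hq e) ∈ (Subring.center T).matrix := by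
  rw [← onFactors_scalar_qAntisymm]
  exact onFactors_mem_matrix_center _ (scalar_mem_matrix_center _)

variable [Algebra ℂ K] [IsScalarTower ℂ K T] {u v : ℕ → K} {M N : ℕ → Matrix (Fin n) (Fin n) T}

theorem semiconjBy_one_sub_pOp (hq : q ≠ 0) (hq2 : q ^ 2 ≠ 1) {u : K} (hu : IsUnit u)
    {a b : ι} {X Y : Matrix (ι → Fin n) (ι → Fin n) T}
    (h : SemiconjBy (rOp T n (algebraMap ℂ K q) a b u (algebraMap ℂ K q ^ 2 * u)) X Y) :
    SemiconjBy (1 - pOp T n q a b) X Y := by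
  have hq' : IsUnit (q * (1 - q ^ 2)) := .mk0 _ (mul_ne_zero hq (sub_ne_zero.2 hq2.symm))
  obtain ⟨c, hc⟩ := hu.mul (hq'.map (algebraMap ℂ K))
  rw [rOp_sq_mul hq, ← hc, SemiconjBy, smul_mul_assoc, mul_smul_comm] at h
  exact c.isUnit.smul_left_cancel.1 h

theorem IsRLLString.legProd_mem_semiconjSubmonoid (hq : q ≠ 0) (hq2 : q ^ 2 ≠ 1)
    (h : IsRLLString (algebraMap ℂ K q) k u M) (e : Fin k ↪ ι) {a b : Fin k}
    (hab : (b : ℕ) = a + 1) :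
    legProd e M ∈ semiconjSubmonoid (1 - repOp T n hq e (Equiv.swap a b)) ⊤ := by
  have hb := b.2
  have hne : e a ≠ e b := e.injective.ne (by rintro rfl; omega)
  rw [repOp_swap hq e hab]
  refine list_prod_finRange_mem hab (fun c hca hcb => ?_)
    ⟨onFactor (e b) (M b) * onFactor (e a) (M a), trivial, ?_⟩
  · refine mem_semiconjSubmonoid_of_commute ((Commute.one_left _).sub_left ?_) trivial
    exact swapOp_commute_onFactor hne (e.injective.ne hca) (e.injective.ne hcb) _ _ _
  · refine semiconjBy_one_sub_pOp hq hq2 (h.isUnit a a.2) ?_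
    have hrll := h.rll a (by omega)
    rw [h.succ a (by omega), ← hab] at hrll
    exact hrll.semiconjBy_swapOp hne

theorem IsRLLPair.fusedR_mem_semiconjSubmonoid_left (hq : q ≠ 0) (hq2 : q ^ 2 ≠ 1)
    (hM : IsRLLString (algebraMap ℂ K q) k u M) (h : IsRLLPair (algebraMap ℂ K q) k l u v M N)
    {e : Fin k ↪ ι} {e' : Fin l ↪ ι} (hd : ∀ a b, e a ≠ e' b) {a b : Fin k}
    (hab : (b : ℕ) = a + 1) :
    fusedR T n (algebraMap ℂ K q) e e' u v
      ∈ semiconjSubmonoid (1 - repOp T n hq e (Equiv.swap a b)) (IsUnit.submonoid _) := by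
  have hb := b.2
  have hne : e a ≠ e b := e.injective.ne (by rintro rfl; omega)
  have hrow := fun c : Fin k => h.isUnit_fusedRow c (e c) e'
  rw [repOp_swap hq e hab]
  refine list_prod_finRange_mem hab (fun c hca hcb => ?_) ⟨_, (hrow b).mul (hrow a), ?_⟩
  · refine mem_semiconjSubmonoid_of_commute ((Commute.one_left _).sub_left ?_) (hrow c)
    exact pOp_commute_fusedRow hne (e.injective.ne hca.symm) (e.injective.ne hcb.symm) (hd a) (hd b)
      (hd c) _ _ _
  · rw [fusedRow_mul_fusedRow hne (hd a) (hd b), fusedRow_mul_fusedRow hne.symm (hd b) (hd a)]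
    refine semiconjBy_list_map_prod fun c _ =>
      semiconjBy_one_sub_pOp hq hq2 (hM.isUnit a a.2) ?_
    rw [← hM.succ a (by omega), ← hab]
    exact rOp_yang_baxter _ _ _ _ hne (hd a c) (hd b c)

theorem IsRLLPair.fusedR_mem_semiconjSubmonoid_right (hq : q ≠ 0) (hq2 : q ^ 2 ≠ 1)
    (hN : IsRLLString (algebraMap ℂ K q) l v N) (h : IsRLLPair (algebraMap ℂ K q) k l u v M N)
    {e : Fin k ↪ ι} {e' : Fin l ↪ ι} (hd : ∀ a b, e a ≠ e' b) {a b : Fin l}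
    (hab : (b : ℕ) = a + 1) :
    fusedR T n (algebraMap ℂ K q) e e' u v
      ∈ semiconjSubmonoid (1 - repOp T n hq e' (Equiv.swap a b)) (IsUnit.submonoid _) := by
  have hb := b.2
  have hne : e' a ≠ e' b := e'.injective.ne (by rintro rfl; omega)
  rw [repOp_swap hq e' hab]
  refine Submonoid.list_prod_mem _ (List.forall_mem_map.2 fun c _ => ?_)
  have hunit : ∀ d : Fin l, IsUnit (rOp T n (algebraMap ℂ K q) (e c) (e' d) (u c) (v d)) :=
    fun d => isUnit_rOp (h.isUnit_left c c.2 d d.2) (h.isUnit_right c c.2 d d.2) _ _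
  refine list_prod_finRange_reverse_mem hab (fun d hda hdb => ?_)
    ⟨_, (hunit a).mul (hunit b), ?_⟩
  · refine mem_semiconjSubmonoid_of_commute ((Commute.one_left _).sub_left ?_) (hunit d)
    exact swapOp_commute_swapOp hne (hd c d) (hd c a).symm (e'.injective.ne hda.symm)
      (hd c b).symm (e'.injective.ne hdb.symm) _ _ _ _
  · refine semiconjBy_one_sub_pOp hq hq2 (hN.isUnit a a.2) ?_
    rw [← hN.succ a (by omega), ← hab]
    have ybe := (rOp_yang_baxter (T := T) (n := n) (algebraMap ℂ K q) (u c) (v a) (v b) (hd c a)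
      (hd c b) hne).eq
    rw [← mul_assoc, mul_assoc _ _ (rOp T n (algebraMap ℂ K q) (e c) (e' a) _ _)] at ybe
    exact ybe.symm

theorem IsRLLPair.trace_mul_legProd_comm (hq : q ≠ 0) (hq2 : q ^ 2 ≠ 1)
    (hM : IsRLLString (algebraMap ℂ K q) k u M) (hN : IsRLLString (algebraMap ℂ K q) l v N)
    (h : IsRLLPair (algebraMap ℂ K q) k l u v M N) {e : Fin k ↪ ι} {e' : Fin l ↪ ι}
    (hd : Disjoint (range e) (range e')) :
    (antisymmetrizer (repOp T n hq e) * antisymmetrizer (repOp T n hq e')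
        * (legProd e M * legProd e' N)).trace
      = (antisymmetrizer (repOp T n hq e) * antisymmetrizer (repOp T n hq e')
        * (legProd e' N * legProd e M)).trace := by
  have hne := Set.disjoint_range_iff.1 hd
  obtain ⟨R, hR⟩ := h.isUnit_fusedR (T := T) e e'
  have left : ∀ a b : Fin k, (b : ℕ) = a + 1 → R.val ∈ _ := fun a b hab => by
    rw [hR]; exact h.fusedR_mem_semiconjSubmonoid_left hq hq2 hM hne hab
  have right : ∀ a b : Fin l, (b : ℕ) = a + 1 → R.val ∈ _ := fun a b hab => by
    rw [hR]; exact h.fusedR_mem_semiconjSubmonoid_right hq hq2 hN hne hab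
  refine trace_mul_eq_of_intertwiner (r := R) ?_ ?_
    (mul_antisymmetrizer_mul_antisymmetrizer hq hd
      (fun a b hab => semiconjSubmonoid_le_top _ _ (left a b hab))
      fun a b hab => semiconjSubmonoid_le_top _ _ (right a b hab))
    (mul_antisymmetrizer_mul_antisymmetrizer hq hd
      (fun a b hab => semiconjSubmonoid_le_top _ _ (inv_mem_semiconjSubmonoid (left a b hab)))
      fun a b hab => semiconjSubmonoid_le_top _ _ (inv_mem_semiconjSubmonoid (right a b hab)))
    (mul_antisymmetrizer_mul_antisymmetrizer hq hd
      (fun a b hab => mul_mem (legProd_mem_semiconjSubmonoid_of_disjoint hq hd _ _)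
        (hM.legProd_mem_semiconjSubmonoid hq hq2 e hab))
      fun a b hab => mul_mem (hN.legProd_mem_semiconjSubmonoid hq hq2 e' hab)
        (legProd_mem_semiconjSubmonoid_of_disjoint hq hd.symm _ _)) ?_
  · rw [(antisymmetrizer_repOp_commute hq hd).symm.mul_mul_mul_comm, antisymmetrizer_mul_self,
      antisymmetrizer_mul_self]
  · refine mul_mem ?_ ?_
    · exact mul_mem (antisymmetrizer_repOp_mem_matrix_center hq e)
        (antisymmetrizer_repOp_mem_matrix_center hq e')
    · rw [hR]
      exact fusedR_mem_matrix_center _ _ _ _ _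
  · rw [hR]
    exact h.semiconjBy_fusedR hne

theorem IsRLLPair.antisymmTrace_commute (hq : q ≠ 0) (hq2 : q ^ 2 ≠ 1)
    (hM : IsRLLString (algebraMap ℂ K q) k u M) (hN : IsRLLString (algebraMap ℂ K q) l v N)
    (h : IsRLLPair (algebraMap ℂ K q) k l u v M N) :
    Commute (antisymmTrace q M k) (antisymmTrace q N l) := by
  have hd : Disjoint (range (Function.Embedding.inl : Fin k ↪ Fin k ⊕ Fin l))
      (range (Function.Embedding.inr : Fin l ↪ Fin k ⊕ Fin l)) :=
    Set.disjoint_range_iff.2 fun _ _ => Sum.inl_ne_inr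
  have hbij : Function.Bijective (Sum.elim (Sum.inl : Fin k → Fin k ⊕ Fin l) Sum.inr) := by
    rw [Sum.elim_inl_inr]
    exact Function.bijective_id
  rw [Commute, SemiconjBy, antisymmTrace_mul_antisymmTrace hq (e := .inl) (e' := .inr) hbij,
    antisymmTrace_mul_antisymmTrace hq (e := (.inr : Fin l ↪ Fin k ⊕ Fin l)) (e' := .inl)
      (Equiv.sumComm _ _).bijective,
    h.trace_mul_legProd_comm hq hq2 hM hN hd, (antisymmetrizer_repOp_commute hq hd).eq]

end Transfer

/-! ### Splitting off the last tensor factor -/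

section ExtendPerm

variable {j : ℕ}

/-- The inclusion of symmetric groups as the stabilizer of the last point. -/
def extendPerm : Equiv.Perm (Fin j) →* Equiv.Perm (Fin (j + 1)) :=
  Equiv.Perm.viaEmbeddingHom Fin.castSuccEmb

theorem extendPerm_castSucc (τ : Equiv.Perm (Fin j)) (i : Fin j) :
    extendPerm τ i.castSucc = (τ i).castSucc :=
  Equiv.Perm.viaEmbedding_apply _ _ _

theorem extendPerm_last (τ : Equiv.Perm (Fin j)) : extendPerm τ (Fin.last j) = Fin.last j :=
  Equiv.Perm.viaEmbedding_apply_of_notMem _ _ _ fun ⟨i, hi⟩ => (Fin.castSucc_lt_last i).ne hi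

theorem sign_extendPerm (τ : Equiv.Perm (Fin j)) :
    Equiv.Perm.sign (extendPerm τ) = Equiv.Perm.sign τ := by
  rw [extendPerm, Equiv.Perm.viaEmbeddingHom_apply, Equiv.Perm.viaEmbedding]
  exact @Equiv.Perm.sign_extendDomain _ _ _ _ _ _ τ _ (_) _

theorem swap_last_mul_extendPerm_bijective :
    Function.Bijective fun p : Fin (j + 1) × Equiv.Perm (Fin j) =>
      Equiv.swap (Fin.last j) p.1 * extendPerm p.2 := by
  rw [Fintype.bijective_iff_injective_and_card]
  refine ⟨fun ⟨a, τ⟩ ⟨b, σ⟩ h => ?_, by simp [Fintype.card_perm, Nat.factorial_succ]⟩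
  obtain rfl : a = b := by
    simpa only [Equiv.Perm.mul_apply, extendPerm_last, Equiv.swap_apply_left]
      using congrArg (· (Fin.last j)) h
  exact congrArg (Prod.mk a) (Equiv.Perm.viaEmbeddingHom_injective _ (mul_left_cancel h))

variable {A : Type*} [Ring A] [Algebra ℂ A]

theorem smul_antisymmetrizer_succ (ρ : Equiv.Perm (Fin (j + 1)) →* A) :
    ((j + 1 : ℕ) : ℂ) • antisymmetrizer ρ
      = (1 - ∑ a : Fin j, ρ (Equiv.swap (Fin.last j) a.castSucc))
        * antisymmetrizer (ρ.comp extendPerm) := by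
  have hcoset : ∀ a, ∑ τ : Equiv.Perm (Fin j),
      Equiv.Perm.sign (Equiv.swap (Fin.last j) a * extendPerm τ)
        • ρ (Equiv.swap (Fin.last j) a * extendPerm τ)
      = (Equiv.Perm.sign (Equiv.swap (Fin.last j) a) • ρ (Equiv.swap (Fin.last j) a))
        * ∑ τ, Equiv.Perm.sign τ • (ρ.comp extendPerm) τ := fun a => by
    rw [Finset.mul_sum]
    refine Finset.sum_congr rfl fun τ _ => ?_
    rw [map_mul, map_mul, sign_extendPerm, smul_mul_smul_comm, MonoidHom.comp_apply]
  have hneg : ∀ a : Fin j, Equiv.Perm.sign (Equiv.swap (Fin.last j) a.castSucc)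
      • ρ (Equiv.swap (Fin.last j) a.castSucc) = -ρ (Equiv.swap (Fin.last j) a.castSucc) :=
    fun a => by rw [Equiv.Perm.sign_swap (Fin.castSucc_lt_last a).ne', Units.neg_smul, one_smul]
  rw [antisymmetrizer, antisymmetrizer, smul_smul, mul_smul_comm, Nat.factorial_succ, Nat.cast_mul,
    mul_inv, mul_inv_cancel_left₀ (Nat.cast_ne_zero.2 j.succ_ne_zero),
    ← swap_last_mul_extendPerm_bijective.sum_comp, Fintype.sum_prod_type]
  simp only [hcoset, ← Finset.sum_mul]
  rw [Fin.sum_univ_castSucc, Equiv.swap_self, ← Equiv.Perm.one_def, map_one, map_one, one_smul]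
  simp only [hneg, Finset.sum_neg_distrib]
  rw [neg_add_eq_sub]

end ExtendPerm

section ExtendRep

variable {T ι κ : Type*} [Ring T] [Algebra ℂ T] [Fintype ι] [DecidableEq ι]
  [Fintype κ] [DecidableEq κ] {n j k : ℕ} {q : ℂ}

theorem permWeight_extendPerm (q : ℂ) (τ : Equiv.Perm (Fin j)) (J : Fin (j + 1) → Fin n) :
    permWeight q (extendPerm τ) J = permWeight q τ (J ∘ Fin.castSucc) := by
  have hlast : ∀ b : Fin (j + 1), ¬Fin.last j < b := fun b => (Fin.le_last b).not_gt
  simp only [permWeight, Fin.prod_univ_castSucc (n := j), extendPerm_last, extendPerm_castSucc,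
    hlast, false_and, and_false, if_false, mul_one, Fin.castSucc_lt_castSucc_iff,
    Finset.prod_const_one, Function.comp_apply]

theorem eq_comp_extendPerm_symm_iff {α : Type*} (τ : Equiv.Perm (Fin j)) (I J : Fin (j + 1) → α) :
    I = J ∘ (extendPerm τ).symm ↔ EqOn I J (range (Fin.castSuccEmb : Fin j ↪ Fin (j + 1)))ᶜ ∧
      I ∘ Fin.castSucc = (J ∘ Fin.castSucc) ∘ τ.symm := by
  have hsymm : (extendPerm τ).symm = extendPerm τ.symm := (map_inv extendPerm τ).symm
  rw [hsymm]
  constructor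
  · rintro rfl
    refine ⟨fun r hr => ?_, funext fun i => by simp [extendPerm_castSucc]⟩
    obtain rfl : r = Fin.last j := by
      by_contra h
      exact hr ⟨r.castPred h, Fin.castSucc_castPred r h⟩
    simp [extendPerm_last]
  · rintro ⟨hlast, hcast⟩
    funext r
    refine Fin.lastCases ?_ (fun i => ?_) r
    · rw [hlast fun ⟨a, ha⟩ => (Fin.castSucc_lt_last a).ne ha]
      simp [extendPerm_last]
    · simpa [extendPerm_castSucc] using congrFun hcast i

theorem repOp_apply (hq : q ≠ 0) (e : Fin k ↪ ι) (σ : Equiv.Perm (Fin k)) :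
    repOp T n hq e σ = onFactors e (scalar T (qPerm n q σ)) :=
  rfl

theorem onFactors_repOp (hq : q ≠ 0) (e : κ ↪ ι) (e' : Fin k ↪ κ) (σ : Equiv.Perm (Fin k)) :
    onFactors e (repOp T n hq e' σ) = repOp T n hq (e'.trans e) σ :=
  onFactors_onFactors _ _ _

theorem repOp_extendPerm (hq : q ≠ 0) (e : Fin (j + 1) ↪ ι) (σ : Equiv.Perm (Fin j)) :
    repOp T n hq e (extendPerm σ) = repOp T n hq (Fin.castSuccEmb.trans e) σ := by
  classical
  rw [repOp_apply, repOp_apply, ← onFactors_onFactors]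
  congr 1
  ext I J
  rw [onFactors_apply]
  simp only [scalar, Matrix.map_apply, qPerm, Matrix.of_apply, permWeight_extendPerm,
    eq_comp_extendPerm_symm_iff, ite_and, apply_ite (algebraMap ℂ T), map_zero]
  rfl

end ExtendRep

section PartialTrace

variable {T : Type*} [Ring T] {n j : ℕ} {q : ℂ}

/-- The multi-index `I` followed by the index `i`. -/
abbrev snocIdx (I : Fin j → Fin n) (i : Fin n) : Fin (j + 1) → Fin n :=
  Fin.snoc (α := fun _ => Fin n) I i

theorem sum_snocIdx {A : Type*} [AddCommMonoid A] (f : (Fin (j + 1) → Fin n) → A) :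
    ∑ I, f I = ∑ i : Fin n, ∑ I : Fin j → Fin n, f (snocIdx I i) := by
  rw [← Fintype.sum_prod_type', ← (Fin.snocEquiv fun _ : Fin (j + 1) => Fin n).sum_comp]
  rfl

theorem snocIdx_comp_castSuccEmb (I : Fin j → Fin n) (i : Fin n) :
    snocIdx I i ∘ (Fin.castSuccEmb : Fin j ↪ Fin (j + 1)) = I :=
  funext fun a => Fin.snoc_castSucc (α := fun _ => Fin n) _ _ a

theorem compl_range_castSuccEmb :
    (range (Fin.castSuccEmb : Fin j ↪ Fin (j + 1)))ᶜ = {Fin.last j} := by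
  ext r
  refine Fin.lastCases ?_ (fun i => ?_) r <;> simp

theorem onFactors_castSuccEmb_apply (Y : Matrix (Fin j → Fin n) (Fin j → Fin n) T)
    (I J : Fin j → Fin n) (i k : Fin n) :
    onFactors Fin.castSuccEmb Y (snocIdx I i) (snocIdx J k)
      = if i = k then Y I J else 0 := by
  classical
  rw [onFactors_apply, compl_range_castSuccEmb, snocIdx_comp_castSuccEmb,
    snocIdx_comp_castSuccEmb, Set.eqOn_singleton]
  simp only [Fin.snoc_last]

theorem onFactors_castSuccEmb_mul_onFactor_last_apply
    (Y : Matrix (Fin j → Fin n) (Fin j → Fin n) T) (N : Matrix (Fin n) (Fin n) T)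
    (I J : Fin j → Fin n) (i k : Fin n) :
    (onFactors Fin.castSuccEmb Y * onFactor (Fin.last j) N) (snocIdx I i) (snocIdx J k)
      = Y I J * N i k := by
  classical
  have hlast : Fin.last j ∈ (range (Fin.castSuccEmb : Fin j ↪ Fin (j + 1)))ᶜ :=
    compl_range_castSuccEmb ▸ rfl
  rw [onFactors_mul_onFactor_apply hlast, if_pos, snocIdx_comp_castSuccEmb,
    snocIdx_comp_castSuccEmb]
  · simp only [Fin.snoc_last]
  · rw [Set.insert_eq, Set.compl_union, compl_range_castSuccEmb, Set.compl_inter_self]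
    exact Set.eqOn_empty _ _

theorem legProd_succ (M : ℕ → Matrix (Fin n) (Fin n) T) :
    legProd (Function.Embedding.refl (Fin (j + 1))) M
      = onFactors Fin.castSuccEmb (legProd (Function.Embedding.refl (Fin j)) M)
        * onFactor (Fin.last j) (M j) := by
  rw [onFactors_legProd, legProd, List.finRange_succ_last, List.map_append, List.prod_append,
    List.map_map, List.map_singleton, List.prod_singleton]
  rfl

variable [Algebra ℂ T]

/-- The trace over all tensor factors but the last. -/
def partialTrace : Matrix (Fin (j + 1) → Fin n) (Fin (j + 1) → Fin n) T →ₗ[ℂ]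
    Matrix (Fin n) (Fin n) T where
  toFun X := Matrix.of fun i k => (X.submatrix (snocIdx · i) (snocIdx · k)).trace
  map_add' _ _ := Matrix.ext fun _ _ => Matrix.trace_add _ _
  map_smul' c _ := Matrix.ext fun _ _ => Matrix.trace_smul c _

theorem partialTrace_apply (X : Matrix (Fin (j + 1) → Fin n) (Fin (j + 1) → Fin n) T)
    (i k : Fin n) :
    partialTrace X i k = ∑ I : Fin j → Fin n, X (snocIdx I i) (snocIdx I k) :=
  rfl

theorem trace_partialTrace (X : Matrix (Fin (j + 1) → Fin n) (Fin (j + 1) → Fin n) T) :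
    (partialTrace X).trace = X.trace :=
  (sum_snocIdx fun I => X I I).symm

theorem partialTrace_onFactors_mul_comm {C : Matrix (Fin j → Fin n) (Fin j → Fin n) T}
    (hC : C ∈ (Subring.center T).matrix)
    (X : Matrix (Fin (j + 1) → Fin n) (Fin (j + 1) → Fin n) T) :
    partialTrace (onFactors Fin.castSuccEmb C * X)
      = partialTrace (X * onFactors Fin.castSuccEmb C) := by
  ext i k
  have left : (onFactors Fin.castSuccEmb C * X).submatrix (snocIdx · i) (snocIdx · k)
      = C * X.submatrix (snocIdx · i) (snocIdx · k) := by
    ext I J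
    simp only [Matrix.submatrix_apply, Matrix.mul_apply, sum_snocIdx, onFactors_castSuccEmb_apply]
    rw [Finset.sum_comm]
    simp
  have right : (X * onFactors Fin.castSuccEmb C).submatrix (snocIdx · i) (snocIdx · k)
      = X.submatrix (snocIdx · i) (snocIdx · k) * C := by
    ext I J
    simp only [Matrix.submatrix_apply, Matrix.mul_apply, sum_snocIdx, onFactors_castSuccEmb_apply]
    rw [Finset.sum_comm]
    simp
  change (Matrix.submatrix _ _ _).trace = (Matrix.submatrix _ _ _).trace
  rw [left, right, trace_mul_comm_of_mem_matrix_center hC]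

theorem partialTrace_onFactors_mul_onFactor (Y : Matrix (Fin j → Fin n) (Fin j → Fin n) T)
    (N : Matrix (Fin n) (Fin n) T) :
    partialTrace (onFactors Fin.castSuccEmb Y * onFactor (Fin.last j) N)
      = Y.trace • N := by
  ext i k
  simp only [partialTrace_apply, onFactors_castSuccEmb_mul_onFactor_last_apply, Matrix.trace,
    Matrix.diag_apply, Matrix.smul_apply, smul_eq_mul, Finset.sum_mul]

theorem snocIdx_snocIdx_comp_swap (I : Fin j → Fin n) (i k : Fin n) :
    snocIdx (snocIdx I i) k ∘ Equiv.swap (Fin.last j).castSucc (Fin.last (j + 1))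
      = snocIdx (snocIdx I k) i := by
  funext r
  refine Fin.lastCases ?_ (fun r => Fin.lastCases ?_ (fun r => ?_) r) r
  · simp
  · simp
  · rw [Function.comp_apply, Equiv.swap_apply_of_ne_of_ne]
    · simp
    · exact (Fin.castSucc_injective _).ne (Fin.castSucc_lt_last r).ne
    · exact (Fin.castSucc_lt_last _).ne

theorem partialTrace_pOp_mul (q : ℂ) (Y : Matrix (Fin (j + 1) → Fin n) (Fin (j + 1) → Fin n) T)
    (N : Matrix (Fin n) (Fin n) T) :
    partialTrace (pOp T n q (Fin.last j).castSucc (Fin.last (j + 1))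
        * (onFactors Fin.castSuccEmb Y * onFactor (Fin.last (j + 1)) N))
      = qMul q (partialTrace Y) N := by
  ext i k
  simp only [partialTrace_apply, qMul, Matrix.of_apply]
  rw [sum_snocIdx]
  refine Finset.sum_congr rfl fun c _ => ?_
  rw [Finset.sum_mul, Finset.smul_sum]
  refine Finset.sum_congr rfl fun I _ => ?_
  rw [pOp_mul_apply, snocIdx_snocIdx_comp_swap, onFactors_castSuccEmb_mul_onFactor_last_apply]
  simp only [Fin.snoc_castSucc, Fin.snoc_last]

end PartialTrace

/-! ### Newton identities -/

section AntisymmProd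

variable {T : Type*} [Ring T] [Algebra ℂ T] {n j k : ℕ} {q : ℂ}

/-- `A_k M₀^{(1)} ⋯ M_{k-1}^{(k)}`, whose trace is `antisymmTrace`. -/
def antisymmProd (q : ℂ) (M : ℕ → Matrix (Fin n) (Fin n) T) (k : ℕ) :
    Matrix (Fin k → Fin n) (Fin k → Fin n) T :=
  scalar T (qAntisymm n k q) * legProd (.refl (Fin k)) M

theorem trace_antisymmProd (q : ℂ) (M : ℕ → Matrix (Fin n) (Fin n) T) (k : ℕ) :
    (antisymmProd q M k).trace = antisymmTrace q M k :=
  (antisymmTrace_eq q M k).symm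

theorem onFactors_antisymmProd (hq : q ≠ 0) (e : Fin k ↪ Fin j)
    (M : ℕ → Matrix (Fin n) (Fin n) T) :
    onFactors e (antisymmProd q M k) = antisymmetrizer (repOp T n hq e) * legProd e M := by
  rw [antisymmProd, map_mul, onFactors_scalar_qAntisymm hq, onFactors_legProd]
  rfl

theorem antisymmProd_eq (hq : q ≠ 0) (M : ℕ → Matrix (Fin n) (Fin n) T) (k : ℕ) :
    antisymmProd q M k
      = antisymmetrizer (repOp T n hq (.refl (Fin k))) * legProd (.refl (Fin k)) M := by
  rw [antisymmProd, ← onFactors_scalar_qAntisymm hq, onFactors_refl]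

theorem smul_antisymmProd_succ (hq : q ≠ 0) (M : ℕ → Matrix (Fin n) (Fin n) T) (j : ℕ) :
    ((j + 1 : ℕ) : ℂ) • antisymmProd q M (j + 1)
      = (1 - ∑ a : Fin j, repOp T n hq (.refl _) (Equiv.swap (Fin.last j) a.castSucc))
        * (onFactors Fin.castSuccEmb (antisymmProd q M j) * onFactor (Fin.last j) (M j)) := by
  have hrestrict : (repOp T n hq (.refl (Fin (j + 1)))).comp extendPerm
      = repOp T n hq Fin.castSuccEmb :=
    MonoidHom.ext fun σ => repOp_extendPerm hq (.refl _) σ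
  rw [antisymmProd_eq hq, ← smul_mul_assoc, smul_antisymmetrizer_succ, hrestrict, legProd_succ,
    onFactors_antisymmProd hq, onFactors_legProd, mul_assoc, ← mul_assoc (antisymmetrizer _)]
  rfl

/-- An element on which permutations act through their signs, from both sides. -/
structure IsAntisymmetric {A : Type*} [Ring A] (ρ : Equiv.Perm (Fin k) →* A) (Y : A) : Prop where
  left : ∀ σ, ρ σ * Y = Equiv.Perm.sign σ • Y
  right : ∀ σ, Y * ρ σ = Equiv.Perm.sign σ • Y

theorem isAntisymmetric_antisymmProd {K : Type*} [CommRing K] [Algebra K T] [Algebra ℂ K]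
    [IsScalarTower ℂ K T] (hq : q ≠ 0) (hq2 : q ^ 2 ≠ 1) {u : ℕ → K}
    {M : ℕ → Matrix (Fin n) (Fin n) T} (hM : IsRLLString (algebraMap ℂ K q) k u M) :
    IsAntisymmetric (repOp T n hq (.refl _)) (antisymmProd q M k) where
  left σ := by rw [antisymmProd_eq hq, ← mul_assoc, mul_antisymmetrizer, smul_mul_assoc]
  right σ := by
    rw [antisymmProd_eq hq, ← antisymmetrizer_mul_mul_antisymmetrizer _ fun a b hab =>
      hM.legProd_mem_semiconjSubmonoid hq hq2 (.refl _) hab, mul_assoc, antisymmetrizer_mul,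
      mul_smul_comm]

theorem swap_last_castSucc (a : Fin (j + 1)) :
    Equiv.swap (Fin.last (j + 1)) a.castSucc
      = extendPerm (Equiv.swap a (Fin.last j))
        * Equiv.swap (Fin.last j).castSucc (Fin.last (j + 1))
        * extendPerm (Equiv.swap a (Fin.last j)) := by
  have h := Equiv.swap_apply_apply (extendPerm (Equiv.swap a (Fin.last j)))
    (Fin.last j).castSucc (Fin.last (j + 1))
  rw [extendPerm_castSucc, extendPerm_last, Equiv.swap_apply_right, ← map_inv, Equiv.swap_inv] at h
  rw [Equiv.swap_comm, h]

theorem partialTrace_swap_mul (hq : q ≠ 0)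
    {Y : Matrix (Fin (j + 1) → Fin n) (Fin (j + 1) → Fin n) T}
    (hY : IsAntisymmetric (repOp T n hq (.refl _)) Y) (N : Matrix (Fin n) (Fin n) T)
    (a : Fin (j + 1)) :
    partialTrace (repOp T n hq (.refl _) (Equiv.swap (Fin.last (j + 1)) a.castSucc)
        * (onFactors Fin.castSuccEmb Y * onFactor (Fin.last (j + 1)) N))
      = qMul q (partialTrace Y) N := by
  set σ : Equiv.Perm (Fin (j + 1)) := Equiv.swap a (Fin.last j)
  set s := repOp T n hq (.refl (Fin (j + 1))) σ
  have hs : s ∈ (Subring.center T).matrix :=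
    onFactors_mem_matrix_center _ (scalar_mem_matrix_center _)
  have hext : repOp T n hq (.refl _) (extendPerm σ) = onFactors Fin.castSuccEmb s := by
    rw [repOp_extendPerm, onFactors_repOp]
    rfl
  have hlast : repOp T n hq (.refl _) (Equiv.swap (Fin.last j).castSucc (Fin.last (j + 1)))
      = pOp T n q (Fin.last j).castSucc (Fin.last (j + 1)) :=
    repOp_swap hq (.refl _) rfl
  have hcomm : Commute (onFactors Fin.castSuccEmb s) (onFactor (Fin.last (j + 1)) N) :=
    onFactors_commute_onFactors (by simp [range_punit]) hs _
  have left : onFactors Fin.castSuccEmb s * (onFactors Fin.castSuccEmb Y * onFactor (Fin.last _) N)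
      = Equiv.Perm.sign σ • (onFactors Fin.castSuccEmb Y * onFactor (Fin.last _) N) := by
    rw [← mul_assoc, ← map_mul, hY.left, Units.smul_def, map_zsmul, smul_mul_assoc, Units.smul_def]
  have right : onFactors Fin.castSuccEmb Y * onFactor (Fin.last _) N * onFactors Fin.castSuccEmb s
      = Equiv.Perm.sign σ • (onFactors Fin.castSuccEmb Y * onFactor (Fin.last _) N) := by
    rw [mul_assoc, ← hcomm.eq, ← mul_assoc, ← map_mul, hY.right, Units.smul_def, map_zsmul,
      smul_mul_assoc, Units.smul_def]
  rw [swap_last_castSucc, map_mul (repOp ..), map_mul (repOp ..), hext, hlast, mul_assoc, left,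
    mul_assoc, partialTrace_onFactors_mul_comm hs, mul_smul_comm, smul_mul_assoc, mul_assoc, right,
    mul_smul_comm, smul_smul, Int.units_mul_self, one_smul, partialTrace_pOp_mul]

end AntisymmProd

section Newton

variable {T : Type*} [Ring T] [Algebra ℂ T] {n j k : ℕ} {q : ℂ}

/-- Right `q`-multiplication by `B`, as a homomorphism of left modules. -/
def qMulRight (q : ℂ) (B : Matrix (Fin n) (Fin n) T) :
    Matrix (Fin n) (Fin n) T →ₗ[T] Matrix (Fin n) (Fin n) T where
  toFun A := qMul q A B
  map_add' A A' := by
    ext i k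
    simp only [qMul, Matrix.of_apply, Matrix.add_apply, add_mul, smul_add, Finset.sum_add_distrib]
  map_smul' x A := by
    ext i k
    simp only [qMul, Matrix.of_apply, Matrix.smul_apply, smul_eq_mul, Finset.mul_sum,
      mul_smul_comm, mul_assoc, RingHom.id_apply]

theorem qMulRight_apply (A B : Matrix (Fin n) (Fin n) T) : qMulRight q B A = qMul q A B :=
  rfl

theorem one_qMul (B : Matrix (Fin n) (Fin n) T) : qMul q 1 B = B := by
  ext i k
  simp [qMul, Matrix.one_apply]

theorem antisymmTrace_zero (hq : q ≠ 0) (M : ℕ → Matrix (Fin n) (Fin n) T) :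
    antisymmTrace q M 0 = 1 := by
  have h : antisymmProd q M 0 = 1 := by
    rw [antisymmProd_eq hq, legProd, List.finRange_zero, List.map_nil, List.prod_nil, mul_one]
    simp [antisymmetrizer]
  rw [← trace_antisymmProd, h, Matrix.trace_one, Fintype.card_unique, Nat.cast_one]

/-- `j tr_{1,…,j-1} (A_j M₀^{(1)} ⋯ M_{j-1}^{(j)})`, the partial trace leaving out the last
factor. -/
def newtonMatrix (q : ℂ) (M : ℕ → Matrix (Fin n) (Fin n) T) : ℕ → Matrix (Fin n) (Fin n) T
  | 0 => 0
  | j + 1 => ((j + 1 : ℕ) : ℂ) • partialTrace (antisymmProd q M (j + 1))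

theorem trace_newtonMatrix (M : ℕ → Matrix (Fin n) (Fin n) T) (k : ℕ) :
    (newtonMatrix q M k).trace = (k : ℂ) • antisymmTrace q M k := by
  cases k with
  | zero => rw [newtonMatrix, Matrix.trace_zero, Nat.cast_zero, zero_smul]
  | succ k => rw [newtonMatrix, Matrix.trace_smul, trace_partialTrace, trace_antisymmProd]

theorem newtonMatrix_succ (hq : q ≠ 0) {M : ℕ → Matrix (Fin n) (Fin n) T}
    (hM : IsAntisymmetric (repOp T n hq (.refl _)) (antisymmProd q M j)) :
    newtonMatrix q M (j + 1)
      = antisymmTrace q M j • M j - qMulRight q (M j) (newtonMatrix q M j) := by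
  rw [newtonMatrix, ← map_smul, smul_antisymmProd_succ hq, sub_mul, one_mul, map_sub,
    partialTrace_onFactors_mul_onFactor, trace_antisymmProd, Finset.sum_mul, map_sum]
  congr 1
  cases j with
  | zero => rw [newtonMatrix, map_zero, Finset.univ_eq_empty, Finset.sum_empty]
  | succ j =>
    rw [newtonMatrix, LinearMap.map_smul_of_tower, qMulRight_apply, Nat.cast_smul_eq_nsmul]
    simp only [partialTrace_swap_mul hq hM, Finset.sum_const, Finset.card_univ, Fintype.card_fin]

theorem newtonMatrix_eq_sum (hq : q ≠ 0) {M : ℕ → Matrix (Fin n) (Fin n) T} (k : ℕ)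
    (hM : ∀ j < k, IsAntisymmetric (repOp T n hq (.refl _)) (antisymmProd q M j)) :
    newtonMatrix q M k = ∑ m ∈ Finset.range k, (-1 : ℤˣ) ^ (k - m + 1) •
      antisymmTrace q M m • qPow q (fun s => M (m + s)) (k - m) := by
  induction k with
  | zero => rw [newtonMatrix, Finset.range_zero, Finset.sum_empty]
  | succ k ih =>
    rw [newtonMatrix_succ hq (hM k k.lt_succ_self), ih fun j hj => hM j (hj.trans k.lt_succ_self),
      Finset.sum_range_succ, map_sum, sub_eq_neg_add, ← Finset.sum_neg_distrib]
    congr 1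
    · refine Finset.sum_congr rfl fun m hm => ?_
      have hm' : m ≤ k := (Finset.mem_range.1 hm).le
      rw [Units.smul_def, map_zsmul, map_smul, qMulRight_apply, Nat.succ_sub hm', qPow,
        Nat.add_sub_cancel' hm', pow_succ _ (k - m + 1), mul_neg_one, Units.neg_smul,
        Units.smul_def]
    · simp [qPow, one_qMul]

theorem newton_identity (hq : q ≠ 0) {M : ℕ → Matrix (Fin n) (Fin n) T} (k : ℕ)
    (hM : ∀ j < k, IsAntisymmetric (repOp T n hq (.refl _)) (antisymmProd q M j)) :
    (k : ℂ) • antisymmTrace q M k = ∑ m ∈ Finset.range k, (-1 : ℤˣ) ^ (k - m + 1) •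
      (antisymmTrace q M m * qPowTrace q (fun s => M (m + s)) (k - m)) := by
  rw [← trace_newtonMatrix, newtonMatrix_eq_sum hq k hM, Matrix.trace_sum]
  simp only [Matrix.trace_smul, qPowTrace, smul_eq_mul]

theorem qPowTrace_succ (hq : q ≠ 0) {M : ℕ → Matrix (Fin n) (Fin n) T} (k : ℕ)
    (hM : ∀ j < k + 1, IsAntisymmetric (repOp T n hq (.refl _)) (antisymmProd q M j)) :
    qPowTrace q M (k + 1) = (-1 : ℤˣ) ^ k • (((k + 1 : ℕ) : ℂ) • antisymmTrace q M (k + 1)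
      - ∑ m ∈ Finset.range k, (-1 : ℤˣ) ^ (k - m + 1) •
        (antisymmTrace q M (m + 1) * qPowTrace q (fun s => M (m + 1 + s)) (k - m))) := by
  rw [newton_identity hq (k + 1) hM, Finset.sum_range_succ']
  simp only [Nat.add_sub_add_right, antisymmTrace_zero hq, one_mul, zero_add, Nat.sub_zero,
    add_sub_cancel_left, smul_smul, ← pow_add]
  rw [Even.neg_one_pow (by grind), one_smul]

theorem commute_qPowTrace (hq : q ≠ 0) {y : T} (k : ℕ) (M : ℕ → Matrix (Fin n) (Fin n) T)
    (hM : ∀ s j, s + j ≤ k →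
      IsAntisymmetric (repOp T n hq (.refl _)) (antisymmProd q (fun i => M (s + i)) j))
    (hy : ∀ s j, s + j ≤ k → Commute (antisymmTrace q (fun i => M (s + i)) j) y) :
    Commute (qPowTrace q M k) y := by
  induction k using Nat.strong_induction_on generalizing M with
  | _ k ih =>
    cases k with
    | zero =>
      rw [qPowTrace, qPow, Matrix.trace_one]
      exact Nat.cast_commute _ _
    | succ k =>
      rw [qPowTrace_succ hq k fun j hj => by simpa only [zero_add] using hM 0 j (by omega)]
      have ht : ∀ j ≤ k + 1, Commute (antisymmTrace q M j) y := fun j hj => by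
        simpa only [zero_add] using hy 0 j (by omega)
      refine .smul_left (.sub_left (.smul_left (ht _ le_rfl) _) ?_) _
      refine Commute.sum_left _ _ _ fun m hm => .smul_left (.mul_left ?_ ?_) _
      · exact ht _ (by grind)
      · refine ih _ (by omega) _ (fun s j hsj => ?_) fun s j hsj => ?_
        · simpa only [add_assoc] using hM (m + 1 + s) j (by grind)
        · simpa only [add_assoc] using hy (m + 1 + s) j (by grind)

end Newton

/-! ### Commutation up to sign -/

section SignCommute

variable {T : Type*} [Ring T] {β : Type*} {x y : T} {Φ Ψ Θ Φ' Ψ' : β → ℤˣ} {X Y : Matrix β β T}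

/-- `x` commutes up to sign with every entry of `X`, the sign for the entry `(I, J)` being
`Φ I * Ψ J`.  For `q = ±1` the entries of `L`-operators commute in this way. -/
def SignCommute (x : T) (Φ Ψ : β → ℤˣ) (X : Matrix β β T) : Prop :=
  ∀ I J, x * X I J = (Φ I * Ψ J) • (X I J * x)

theorem SignCommute.mul_left (hx : SignCommute x Φ Ψ X) (hy : SignCommute y Φ' Ψ' X) :
    SignCommute (x * y) (Φ * Φ') (Ψ * Ψ') X := fun I J => by
  calc x * y * X I J = (Φ' I * Ψ' J) • (x * X I J * y) := by
        rw [mul_assoc, hy, mul_smul_comm, mul_assoc]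
    _ = ((Φ * Φ') I * (Ψ * Ψ') J) • (X I J * (x * y)) := by
        rw [hx, smul_mul_assoc, smul_smul, mul_assoc (X I J), Pi.mul_apply, Pi.mul_apply,
          mul_comm (Φ' I * _), mul_mul_mul_comm]

theorem SignCommute.apply_mul_apply (hX : SignCommute x Φ Θ X) (hY : SignCommute x Θ Ψ Y)
    (I J K : β) : x * (X I K * Y K J) = (Φ I * Ψ J) • (X I K * Y K J * x) := by
  rw [← mul_assoc, hX, smul_mul_assoc, mul_assoc, hY, mul_smul_comm, smul_smul,
    ← mul_assoc (X I K), ← mul_assoc (Φ I * Θ K), mul_assoc (Φ I), Int.units_mul_self, mul_one]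

theorem SignCommute.one [DecidableEq β] : SignCommute x Φ Φ (1 : Matrix β β T) := fun I J => by
  rw [Matrix.one_apply]
  split_ifs with h
  · rw [h, Int.units_mul_self, one_smul, mul_one, one_mul]
  · rw [mul_zero, zero_mul, smul_zero]

theorem SignCommute.scalar [Algebra ℂ T] {C : Matrix β β ℂ} (hC : ∀ I J, C I J ≠ 0 → Φ I = Φ J) :
    SignCommute x Φ Φ (scalar T C) := fun I J => by
  rw [QLax.scalar, Matrix.map_apply]
  by_cases h : C I J = 0
  · simp only [h, map_zero, mul_zero, zero_mul, smul_zero]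
  · rw [hC I J h, Int.units_mul_self, one_smul, Algebra.commutes]

variable [Fintype β]

theorem SignCommute.mul (hX : SignCommute x Φ Θ X) (hY : SignCommute x Θ Ψ Y) :
    SignCommute x Φ Ψ (X * Y) := fun I J => by
  simp only [Matrix.mul_apply, Finset.mul_sum, Finset.sum_mul, Finset.smul_sum,
    hX.apply_mul_apply hY]

theorem SignCommute.list_prod [DecidableEq β] {L : List (Matrix β β T)}
    (h : ∀ X ∈ L, SignCommute x Φ Φ X) : SignCommute x Φ Φ L.prod := by
  induction L with
  | nil => exact .one
  | cons X L ih =>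
    rw [List.forall_mem_cons] at h
    rw [List.prod_cons]
    exact h.1.mul (ih h.2)

theorem SignCommute.commute_trace (hX : SignCommute x Φ Φ X) : Commute x X.trace :=
  Commute.sum_right _ _ _ fun I _ => (hX I I).trans <| by
    rw [Int.units_mul_self, one_smul, Matrix.diag_apply]

theorem SignCommute.onFactor {ι : Type*} [Fintype ι] [DecidableEq ι]
    {n : ℕ} {φ : Fin n → ℤˣ} {A : Matrix (Fin n) (Fin n) T} (hA : SignCommute x φ φ A) (a : ι) :
    SignCommute x (fun I : ι → Fin n => ∏ s, φ (I s)) (fun I => ∏ s, φ (I s)) (onFactor a A) :=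
  fun I J => by
    rw [onFactor_apply]
    split_ifs with h
    · rw [hA, ← Finset.prod_mul_distrib, Finset.prod_eq_single_of_mem a (Finset.mem_univ a)]
      intro s _ hs
      rw [h hs, Int.units_mul_self]
    · rw [mul_zero, zero_mul, smul_zero]

end SignCommute

section SignCommuteTraces

variable {T : Type*} [Ring T] [Algebra ℂ T] {n k l : ℕ} {q : ℂ} {x : T} {φ : Fin n → ℤˣ}
  {N : ℕ → Matrix (Fin n) (Fin n) T}

theorem SignCommute.qMul {θ ψ : Fin n → ℤˣ} {A B : Matrix (Fin n) (Fin n) T}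
    (hA : SignCommute x φ θ A) (hB : SignCommute x θ ψ B) : SignCommute x φ ψ (qMul q A B) :=
  fun i j => by
    simp only [QLax.qMul, Matrix.of_apply, Finset.mul_sum, Finset.sum_mul, Finset.smul_sum,
      mul_smul_comm, smul_mul_assoc, hA.apply_mul_apply hB, smul_comm (φ i * ψ j)]

theorem SignCommute.qPow (hN : ∀ b < l, SignCommute x φ φ (N b)) :
    SignCommute x φ φ (qPow q N l) := by
  induction l with
  | zero => exact .one
  | succ l ih => exact (ih fun b hb => hN b (by lia)).qMul (hN l (by lia))

theorem prod_comp_eq_of_qAntisymm_ne_zero {I J : Fin l → Fin n} (h : qAntisymm n l q I J ≠ 0)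
    (φ : Fin n → ℤˣ) : ∏ s, φ (I s) = ∏ s, φ (J s) := by
  obtain ⟨τ, hτ⟩ : ∃ τ : Equiv.Perm (Fin l), qPerm n q τ I J ≠ 0 := by
    contrapose! h
    simp only [qAntisymm, Matrix.smul_apply, Matrix.sum_apply, h, smul_zero,
      Finset.sum_const_zero]
  have hI : I = J ∘ τ.symm := by
    by_contra hI
    exact hτ (if_neg hI)
  rw [hI]
  exact Equiv.prod_comp τ.symm fun s => φ (J s)

theorem SignCommute.commute_qPowTrace (hN : ∀ b < l, SignCommute x φ φ (N b)) :
    Commute x (qPowTrace q N l) :=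
  (SignCommute.qPow hN).commute_trace

theorem SignCommute.commute_antisymmTrace (hN : ∀ b < l, SignCommute x φ φ (N b)) :
    Commute x (antisymmTrace q N l) := by
  rw [antisymmTrace_eq]
  refine ((SignCommute.scalar fun I J h => prod_comp_eq_of_qAntisymm_ne_zero h φ).mul
    (.list_prod fun X hX => ?_)).commute_trace
  obtain ⟨s, -, rfl⟩ := List.mem_map.1 hX
  exact (hN s s.2).onFactor s

end SignCommuteTraces

section SignWeight

variable {T : Type*} [Ring T] [Algebra ℂ T] {n k l : ℕ} {q : ℂ} {ε : ℤˣ}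
  {M N : ℕ → Matrix (Fin n) (Fin n) T}

/-- The coefficients of the diagonal part of the `R`-matrix at `q = ε`, up to a common factor. -/
def signWeight (ε : ℤˣ) (i j : Fin n) : ℤˣ := if i = j then 1 else ε

theorem qPow_mem_span_signCommute
    (h : ∀ a < k, ∀ b < l, ∀ i j,
      SignCommute (M a i j) (signWeight ε i) (signWeight ε j) (N b)) (i j : Fin n) :
    qPow q M k i j ∈ Submodule.span ℂ {x : T | ∃ φ : Fin n → ℤˣ,
      ∀ b < l, SignCommute x (φ * signWeight ε i) (φ * signWeight ε j) (N b)} := by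
  induction k generalizing j with
  | zero =>
    rw [qPow, Matrix.one_apply]
    split_ifs with hij
    · have hw : signWeight ε i * signWeight ε i = 1 := funext fun r => Int.units_mul_self _
      refine Submodule.subset_span ⟨signWeight ε i, fun b _ r s => ?_⟩
      rw [← hij, hw, Pi.one_apply, Pi.one_apply, one_mul, one_mul, one_smul, mul_one]
    · exact Submodule.zero_mem _
  | succ k ih =>
    rw [qPow, qMul, Matrix.of_apply]
    refine Submodule.sum_mem _ fun a _ => Submodule.smul_mem _ _ ?_
    have hqPow := ih (fun b hb => h b (by lia)) a
    generalize qPow q M k i a = z at hqPow ⊢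
    induction hqPow using Submodule.span_induction with
    | mem x hx =>
      obtain ⟨φ, hφ⟩ := hx
      refine Submodule.subset_span ⟨φ * signWeight ε a, fun b hb => ?_⟩
      have := (hφ b hb).mul_left (h k (by lia) b hb a j)
      rwa [mul_right_comm] at this
    | zero =>
      rw [zero_mul]
      exact Submodule.zero_mem _
    | add x y _ _ hx hy =>
      rw [add_mul]
      exact Submodule.add_mem _ hx hy
    | smul c x _ hx =>
      rw [smul_mul_assoc]
      exact Submodule.smul_mem _ c hx

theorem commute_qPowTrace_of_signCommute
    (h : ∀ a < k, ∀ b < l, ∀ i j,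
      SignCommute (M a i j) (signWeight ε i) (signWeight ε j) (N b)) {y : T}
    (hy : ∀ (x : T) (φ : Fin n → ℤˣ), (∀ b < l, SignCommute x φ φ (N b)) → Commute x y) :
    Commute (qPowTrace q M k) y := by
  rw [qPowTrace, Matrix.trace]
  refine Commute.sum_left _ _ _ fun i _ => ?_
  rw [Matrix.diag_apply]
  have hqPow := qPow_mem_span_signCommute (q := q) h i i
  generalize qPow q M k i i = z at hqPow ⊢
  induction hqPow using Submodule.span_induction with
  | mem x hx =>
    obtain ⟨φ, hφ⟩ := hx
    exact hy x _ hφ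
  | zero => exact Commute.zero_left y
  | add x z _ _ hx hz => exact hx.add_left hz
  | smul c x _ hx => exact hx.smul_left c

end SignWeight

section RLLSign

variable {T : Type*} [Ring T] {n : ℕ} {K : Type*} [CommRing K] [Algebra K T] {ε : ℤˣ}

theorem intCast_units_sq (K : Type*) [Ring K] (ε : ℤˣ) : ((ε : ℤ) : K) ^ 2 = 1 := by
  rw [← Int.cast_pow, ← Units.val_pow_eq_pow_val, Int.units_sq, Units.val_one, Int.cast_one]

theorem rDiag_intCast_units (u v : K) (i j : Fin n) :
    rDiag ((ε : ℤ) : K) u v i j = ((signWeight ε i j : ℤ) : K) * (u - v) := by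
  unfold rDiag signWeight
  split_ifs
  · rw [intCast_units_sq, one_mul, Units.val_one, Int.cast_one, one_mul]
  · rfl

theorem RLL.signCommute {u v : K} {A B : Matrix (Fin n) (Fin n) T} (hR : IsUnit (u - v))
    (h : RLL ((ε : ℤ) : K) u v A B) (i j : Fin n) :
    SignCommute (A i j) (signWeight ε i) (signWeight ε j) B := fun r s => by
  have hp : ∀ i j : Fin n, rPerm ((ε : ℤ) : K) u v i j = 0 := fun i j => by
    simp only [rPerm, intCast_units_sq, sub_self, zero_mul, ite_self]
  obtain ⟨c, hc⟩ := hR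
  have key := h i j r s
  simp only [rDiag_intCast_units, hp, zero_smul, add_zero, ← hc, mul_comm _ c.val, mul_smul,
    Int.cast_smul_eq_zsmul] at key
  have key' : signWeight ε i r • (A i j * B r s) = signWeight ε j s • (B r s * A i j) :=
    c.isUnit.smul_left_cancel.1 key
  rw [mul_smul, ← key', smul_smul, Int.units_mul_self, one_smul]

end RLLSign

section Sequences

variable {T : Type*} [Ring T] {n : ℕ} {K : Type*} [CommRing K] [Algebra K T] {k l : ℕ} {q : ℂ}
  {M N : ℕ → Matrix (Fin n) (Fin n) T} {u v : ℕ → K}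

theorem IsRLLPair.signCommute {ε : ℤˣ} (h : IsRLLPair ((ε : ℤ) : K) k l u v M N) :
    ∀ a < k, ∀ b < l, ∀ i j,
      SignCommute (M a i j) (signWeight ε i) (signWeight ε j) (N b) := fun a ha b hb =>
  RLL.signCommute (by simpa only [intCast_units_sq, one_mul] using h.isUnit_left a ha b hb)
    (h.rll a ha b hb)

variable [Algebra ℂ T] [Algebra ℂ K] [IsScalarTower ℂ K T]

theorem IsRLLPair.commute_qPowTrace_antisymmTrace (hq : q ≠ 0) (hq2 : q ^ 2 ≠ 1)
    (hM : IsRLLString (algebraMap ℂ K q) k u M) (hN : IsRLLString (algebraMap ℂ K q) l v N)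
    (h : IsRLLPair (algebraMap ℂ K q) k l u v M N) :
    Commute (qPowTrace q M k) (antisymmTrace q N l) := by
  refine commute_qPowTrace hq k M
    (fun s i hs => isAntisymmetric_antisymmProd hq hq2 (hM.shift hs)) fun s i hs => ?_
  have hN' : IsRLLString (algebraMap ℂ K q) l (fun b => v (0 + b)) fun b => N (0 + b) :=
    hN.shift (zero_add l).le
  simpa only [zero_add] using
    (h.shift hs (zero_add l).le).antisymmTrace_commute hq hq2 (hM.shift hs) hN'

theorem IsRLLPair.commute_qPowTrace (hq : q ≠ 0) (hq2 : q ^ 2 ≠ 1)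
    (hM : IsRLLString (algebraMap ℂ K q) k u M) (hN : IsRLLString (algebraMap ℂ K q) l v N)
    (h : IsRLLPair (algebraMap ℂ K q) k l u v M N) :
    Commute (qPowTrace q M k) (qPowTrace q N l) := by
  refine .symm (QLax.commute_qPowTrace hq l N
    (fun s j hs => isAntisymmetric_antisymmProd hq hq2 (hN.shift hs)) fun s j hs => .symm ?_)
  have hM' : IsRLLString (algebraMap ℂ K q) k (fun a => u (0 + a)) fun a => M (0 + a) :=
    hM.shift (zero_add k).le
  simpa only [zero_add] using
    (h.shift (zero_add k).le hs).commute_qPowTrace_antisymmTrace hq hq2 hM' (hN.shift hs)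

theorem IsRLLPair.commute (hq : q ≠ 0) (hM : IsRLLString (algebraMap ℂ K q) k u M)
    (hN : IsRLLString (algebraMap ℂ K q) l v N) (h : IsRLLPair (algebraMap ℂ K q) k l u v M N) :
    Commute (qPowTrace q M k) (qPowTrace q N l) ∧
      Commute (qPowTrace q M k) (antisymmTrace q N l) := by
  by_cases hq2 : q ^ 2 = 1
  · obtain ⟨ε, rfl⟩ : ∃ ε : ℤˣ, q = ((ε : ℤ) : ℂ) := by
      rcases mul_self_eq_one_iff.1 (sq q ▸ hq2) with rfl | rfl
      · exact ⟨1, by simp⟩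
      · exact ⟨-1, by simp⟩
    rw [map_intCast] at h
    exact ⟨commute_qPowTrace_of_signCommute h.signCommute fun _ _ hx =>
        SignCommute.commute_qPowTrace hx,
      commute_qPowTrace_of_signCommute h.signCommute fun _ _ hx =>
        SignCommute.commute_antisymmTrace hx⟩
  · exact ⟨h.commute_qPowTrace hq hq2 hM hN, h.commute_qPowTrace_antisymmTrace hq hq2 hM hN⟩

end Sequences

/-! ### Entries of the `R`-matrix -/

section Entries

variable {S : Type*} [Ring S] {n : ℕ} {q : ℂ}

theorem E_kronecker_E_apply (i j k l : Fin n) (p r : Fin n × Fin n) :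
    (E i j ⊗ₖ E k l) p r = if p = (i, k) ∧ r = (j, l) then 1 else 0 := by
  simp only [E, Matrix.single_kronecker_single, Matrix.single_apply, mul_one, eq_comm]

theorem sum_E_kronecker_E_self :
    ∑ i : Fin n, (E i i ⊗ₖ E i i) = Matrix.diagonal fun p => if p.1 = p.2 then 1 else 0 := by
  ext ⟨i, k⟩ r
  rw [Matrix.sum_apply, Finset.sum_eq_single_of_mem i (Finset.mem_univ i)]
  · simp only [E_kronecker_E_apply, Matrix.diagonal_apply, Prod.mk.injEq]
    grind
  · intro x _ hx
    rw [E_kronecker_E_apply, if_neg]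
    grind

theorem sum_E_kronecker_E_of_ne :
    ∑ i : Fin n, ∑ j : Fin n, (if i ≠ j then E i i ⊗ₖ E j j else 0)
      = Matrix.diagonal fun p => if p.1 = p.2 then 0 else 1 := by
  ext ⟨i, k⟩ r
  have key : ∀ x y : Fin n, (if x ≠ y then E x x ⊗ₖ E y y else 0) (i, k) r
      = if x = i then if y = k then if i ≠ k ∧ r = (i, k) then 1 else 0 else 0 else 0 :=
    fun x y => by
      rw [Matrix.ite_apply, E_kronecker_E_apply, Matrix.zero_apply]
      grind
  simp only [Matrix.sum_apply, key, Finset.sum_ite_irrel, Finset.sum_ite_eq', Finset.mem_univ,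
    if_true, Finset.sum_const_zero, Matrix.diagonal_apply]
  grind

theorem sum_E_kronecker_E_of_lt (u v : ℂ) :
    ∑ i : Fin n, ∑ j : Fin n, (if i < j then u • (E i j ⊗ₖ E j i) + v • (E j i ⊗ₖ E i j) else 0)
      = Matrix.diagonal (fun p => if p.1 < p.2 then u else if p.2 < p.1 then v else 0)
        * Equiv.Perm.permMatrix ℂ (Equiv.prodComm (Fin n) (Fin n)) := by
  ext ⟨i, k⟩ r
  have key : ∀ x y : Fin n,
      (if x < y then u • (E x y ⊗ₖ E y x) + v • (E y x ⊗ₖ E x y) else 0) (i, k) r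
      = (if x = i then if y = k then if x < y ∧ r = (k, i) then u else 0 else 0 else 0)
        + if x = k then if y = i then if x < y ∧ r = (k, i) then v else 0 else 0 else 0 := by
    intro x y
    simp only [Matrix.ite_apply, Matrix.add_apply, Matrix.smul_apply, E_kronecker_E_apply,
      Matrix.zero_apply, smul_eq_mul]
    grind
  simp only [Matrix.sum_apply, key, Finset.sum_add_distrib, Finset.sum_ite_irrel,
    Finset.sum_ite_eq', Finset.mem_univ, if_true, Finset.sum_const_zero, Matrix.diagonal_mul,
    PEquiv.toMatrix_toPEquiv_apply, Pi.single_apply, Equiv.prodComm_apply, Prod.swap_prod_mk]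
  grind

theorem smul_Rnum (hq : q ≠ 0) (u v : ℂ) :
    q • Rnum n q u v = Matrix.diagonal (fun p => rDiag q u v p.1 p.2)
      + Matrix.diagonal (fun p => rPerm q u v p.1 p.2)
        * Equiv.Perm.permMatrix ℂ (Equiv.prodComm (Fin n) (Fin n)) := by
  have hqq : q * q⁻¹ = 1 := mul_inv_cancel₀ hq
  rw [Rnum, sum_E_kronecker_E_self, sum_E_kronecker_E_of_ne, sum_E_kronecker_E_of_lt, smul_add,
    ← smul_mul_assoc, ← Matrix.diagonal_smul, ← Matrix.diagonal_smul, ← Matrix.diagonal_smul,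
    Matrix.diagonal_add, ← smul_mul_assoc, ← Matrix.diagonal_smul, ← Matrix.diagonal_smul]
  congr 3 <;> ext p
  · simp only [rDiag, Pi.smul_apply, smul_eq_mul]
    split_ifs
    · linear_combination -v * hqq
    · ring
  · simp only [rPerm, Pi.smul_apply, smul_eq_mul]
    split_ifs
    · linear_combination -u * hqq
    · linear_combination -v * hqq
    · ring

theorem kronecker_one_mul_apply (A B : Matrix (Fin n) (Fin n) S) (i k j l : Fin n) :
    ((A ⊗ₖ (1 : Matrix (Fin n) (Fin n) S)) * ((1 : Matrix (Fin n) (Fin n) S) ⊗ₖ B)) (i, k) (j, l)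
      = A i j * B k l := by
  rw [Matrix.mul_apply, Fintype.sum_prod_type]
  simp [Matrix.one_apply]

theorem one_kronecker_mul_apply (A B : Matrix (Fin n) (Fin n) S) (i k j l : Fin n) :
    (((1 : Matrix (Fin n) (Fin n) S) ⊗ₖ B) * (A ⊗ₖ (1 : Matrix (Fin n) (Fin n) S))) (i, k) (j, l)
      = B k l * A i j := by
  rw [Matrix.mul_apply, Fintype.sum_prod_type]
  simp [Matrix.one_apply]

variable [Algebra ℂ S]

theorem scalar_smul {ι κ : Type*} (c : ℂ) (X : Matrix ι κ ℂ) :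
    scalar S (c • X) = c • scalar S X := by
  ext I J
  change algebraMap ℂ S (c * X I J) = c • algebraMap ℂ S (X I J)
  rw [map_mul, Algebra.smul_def]

theorem smul_scalar_Rnum (hq : q ≠ 0) (u v : ℂ) :
    q • scalar S (Rnum n q u v)
      = Matrix.diagonal (fun p => algebraMap ℂ S (rDiag q u v p.1 p.2))
        + Matrix.diagonal (fun p => algebraMap ℂ S (rPerm q u v p.1 p.2))
          * Equiv.Perm.permMatrix S (Equiv.prodComm (Fin n) (Fin n)) := by
  ext p r
  simp only [← scalar_smul, smul_Rnum hq, scalar, Matrix.map_apply, Matrix.add_apply,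
    Matrix.diagonal_mul, Matrix.diagonal_apply, PEquiv.toMatrix_toPEquiv_apply, Pi.single_apply,
    map_add, map_mul, apply_ite (algebraMap ℂ S), map_zero, map_one]

theorem smul_Rnum_mul_apply (hq : q ≠ 0) (u v : ℂ)
    (X : Matrix (Fin n × Fin n) (Fin n × Fin n) S) (i k : Fin n) (r : Fin n × Fin n) :
    q • (scalar S (Rnum n q u v) * X) (i, k) r
      = rDiag q u v i k • X (i, k) r + rPerm q u v i k • X (k, i) r := by
  rw [← Matrix.smul_apply, ← smul_mul_assoc, smul_scalar_Rnum hq, add_mul, mul_assoc,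
    PEquiv.toMatrix_toPEquiv_mul, Matrix.add_apply, Matrix.diagonal_mul, Matrix.diagonal_mul,
    Algebra.smul_def, Algebra.smul_def]
  rfl

theorem smul_mul_Rnum_apply (hq : q ≠ 0) (u v : ℂ)
    (X : Matrix (Fin n × Fin n) (Fin n × Fin n) S) (r : Fin n × Fin n) (j l : Fin n) :
    q • (X * scalar S (Rnum n q u v)) r (j, l)
      = rDiag q u v j l • X r (j, l) + rPerm q u v l j • X r (l, j) := by
  rw [← Matrix.smul_apply, ← mul_smul_comm, smul_scalar_Rnum hq, mul_add, ← mul_assoc,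
    PEquiv.mul_toMatrix_toPEquiv, Matrix.add_apply, Matrix.submatrix_apply, Matrix.mul_diagonal,
    Matrix.mul_diagonal, ← Algebra.commutes, ← Algebra.commutes, Algebra.smul_def,
    Algebra.smul_def]
  rfl

end Entries

/-! ### Functions of a complex parameter -/

section Functions

variable {S : Type*} [Ring S] [Algebra ℂ S] {n k l : ℕ} {q z w : ℂ} {D : Set ℂ}
  {L : ℂ → Matrix (Fin n) (Fin n) S}

theorem RLLOn.rll (h : RLLOn q D L) (hq : q ≠ 0) (h0 : (0 : ℂ) ∉ D) (hz : z ∈ D) (hw : w ∈ D)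
    (hzw : z ≠ w) : RLL q z w (L z) (L w) := by
  have hw0 : w ≠ 0 := ne_of_mem_of_not_mem hw h0
  have hRnum := congrArg (fun X => (z - w) • X) (h z hz w hw hzw)
  simp only at hRnum
  rw [mul_assoc, ← smul_mul_assoc, ← mul_smul_comm, ← scalar_smul, smul_Rmat_div n q z w hw0 hzw]
    at hRnum
  intro i j k l
  simpa only [Matrix.smul_apply, smul_Rnum_mul_apply hq, smul_mul_Rnum_apply hq,
    kronecker_one_mul_apply, one_kronecker_mul_apply]
    using congrArg (fun X => q • X (i, k) (j, l)) hRnum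

theorem RLLOn.isRLLString (h : RLLOn q D L) (hq : q ≠ 0) (h0 : (0 : ℂ) ∉ D)
    (hz : ∀ i < k, q ^ (2 * i) * z ∈ D) :
    IsRLLString q k (fun i => q ^ (2 * i) * z) fun i => L (q ^ (2 * i) * z) where
  isUnit i hi := (ne_of_mem_of_not_mem (hz i hi) h0).isUnit
  succ i _ := by ring
  rll i hi := by
    have hsucc : q ^ (2 * (i + 1)) * z = q ^ 2 * (q ^ (2 * i) * z) := by ring
    by_cases hq2 : q ^ 2 = 1
    · rw [hsucc, hq2, one_mul]
      exact rll_self hq2 _ _ _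
    · refine h.rll hq h0 (hz i (by omega)) (hz (i + 1) hi) fun heq => hq2 ?_
      rw [hsucc] at heq
      exact mul_right_cancel₀ (ne_of_mem_of_not_mem (hz i (by omega)) h0)
        (heq.symm.trans (one_mul _).symm)

theorem zpow_mul_pow_mul_ne_pow_mul (hq : q ≠ 0)
    (hzw : ∀ s : ℤ, -(l : ℤ) ≤ s → s ≤ k → w ≠ q ^ (2 * s) * z) {c : ℤ} (hc : -1 ≤ c) (hc' : c ≤ 1)
    {i j : ℕ} (hi : i < k) (hj : j < l) : q ^ (2 * c) * (q ^ (2 * i) * z) ≠ q ^ (2 * j) * w := by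
  intro heq
  refine hzw (c + i - j) (by omega) (by omega) (mul_left_cancel₀ (pow_ne_zero (2 * j) hq) ?_)
  have hpow : q ^ (2 * c) * q ^ (2 * i) = q ^ (2 * j) * q ^ (2 * (c + i - j) : ℤ) := by
    rw [← zpow_natCast q (2 * j), ← zpow_natCast q (2 * i), ← zpow_add₀ hq, ← zpow_add₀ hq]
    congr 1
    push_cast
    ring
  rw [← heq, ← mul_assoc, ← mul_assoc, hpow]

theorem RLLOn.isRLLPair (h : RLLOn q D L) (hq : q ≠ 0) (h0 : (0 : ℂ) ∉ D)
    (hz : ∀ i < k, q ^ (2 * i) * z ∈ D) (hw : ∀ j < l, q ^ (2 * j) * w ∈ D)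
    (hzw : ∀ s : ℤ, -(l : ℤ) ≤ s → s ≤ k → w ≠ q ^ (2 * s) * z) :
    IsRLLPair q k l (fun i => q ^ (2 * i) * z) (fun j => q ^ (2 * j) * w)
      (fun i => L (q ^ (2 * i) * z)) fun j => L (q ^ (2 * j) * w) where
  isUnit_left i hi j hj := by
    have hne := zpow_mul_pow_mul_ne_pow_mul hq hzw (c := 1) (by omega) le_rfl hi hj
    rw [mul_one, zpow_ofNat] at hne
    exact (sub_ne_zero.2 hne).isUnit
  isUnit_right i hi j hj := by
    have hne := zpow_mul_pow_mul_ne_pow_mul hq hzw (c := -1) le_rfl (by omega) hi hj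
    rw [mul_neg_one, zpow_neg, zpow_ofNat, ne_eq, inv_mul_eq_iff_eq_mul₀ (pow_ne_zero 2 hq)] at hne
    exact (sub_ne_zero.2 (Ne.symm hne)).isUnit
  rll i hi j hj := by
    have hne := zpow_mul_pow_mul_ne_pow_mul hq hzw (c := 0) (by omega) (by omega) hi hj
    rw [mul_zero, zpow_zero, one_mul] at hne
    exact h.rll hq h0 (hz i hi) (hw j hj) hne

theorem RLLOn.commute (h : RLLOn q D L) (hq : q ≠ 0) (h0 : (0 : ℂ) ∉ D)
    (hz : ∀ i < k, q ^ (2 * i) * z ∈ D) (hw : ∀ j < l, q ^ (2 * j) * w ∈ D)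
    (hzw : ∀ s : ℤ, -(l : ℤ) ≤ s → s ≤ k → w ≠ q ^ (2 * s) * z) :
    Commute (I q L k z) (I q L l w) ∧ Commute (I q L k z) (t q L l w) :=
  IsRLLPair.commute hq (h.isRLLString hq h0 hz) (h.isRLLString hq h0 hw)
    (h.isRLLPair hq h0 hz hw hzw)

end Functions

/-! ### Continuous functions -/

section Continuous

open Filter Topology

theorem commute_of_tendsto {S α : Type*} [Mul S] [TopologicalSpace S] [SeparatelyContinuousMul S]
    [T2Space S] {f : Filter α} [f.NeBot] {x y : S} {g : α → S} (h : Tendsto g f (𝓝 y))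
    (hc : ∀ᶠ a in f, Commute x (g a)) : Commute x y :=
  tendsto_nhds_unique_of_eventuallyEq (h.const_mul x) (h.mul_const x) hc

variable {S : Type*} [Ring S] [Algebra ℂ S] [TopologicalSpace S] [IsTopologicalRing S]
  {n k l : ℕ} {q : ℂ} {α : Type*} {f : Filter α}
  {M : α → ℕ → Matrix (Fin n) (Fin n) S} {N : ℕ → Matrix (Fin n) (Fin n) S}

theorem tendsto_qPow (h : ∀ s < l, Tendsto (fun a => M a s) f (𝓝 (N s))) :
    Tendsto (fun a => qPow q (M a) l) f (𝓝 (qPow q N l)) := by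
  induction l with
  | zero => exact tendsto_const_nhds
  | succ l ih =>
    have hpow := ih fun s hs => h s (hs.trans l.lt_succ_self)
    have hlast := h l l.lt_succ_self
    refine tendsto_pi_nhds.2 fun i => tendsto_pi_nhds.2 fun k => ?_
    simp only [qPow, qMul, Matrix.of_apply]
    refine tendsto_finsetSum _ fun j _ => Tendsto.const_smul (Tendsto.mul ?_ ?_) _
    · exact tendsto_pi_nhds.1 (tendsto_pi_nhds.1 hpow i) j
    · exact tendsto_pi_nhds.1 (tendsto_pi_nhds.1 hlast j) k

theorem tendsto_qPowTrace (h : ∀ s < l, Tendsto (fun a => M a s) f (𝓝 (N s))) :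
    Tendsto (fun a => qPowTrace q (M a) l) f (𝓝 (qPowTrace q N l)) :=
  (continuous_id.matrix_trace.tendsto _).comp (tendsto_qPow h)

theorem tendsto_antisymmTrace (h : ∀ s < l, Tendsto (fun a => M a s) f (𝓝 (N s))) :
    Tendsto (fun a => antisymmTrace q (M a) l) f (𝓝 (antisymmTrace q N l)) := by
  refine (continuous_id.matrix_trace.tendsto _).comp (tendsto_const_nhds.mul ?_)
  simp only [List.ofFn_eq_map]
  refine tendsto_list_prod _ fun s _ => tendsto_pi_nhds.2 fun I => tendsto_pi_nhds.2 fun J => ?_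
  simp only [leg, Matrix.of_apply]
  split_ifs
  · exact tendsto_pi_nhds.1 (tendsto_pi_nhds.1 (h s s.2) _) _
  · exact tendsto_const_nhds

theorem RLLOn.commute_of_continuousOn [T2Space S] {D : Set ℂ} {L : ℂ → Matrix (Fin n) (Fin n) S}
    (h : RLLOn q D L) (hq : q ≠ 0) (h0 : (0 : ℂ) ∉ D) (hD : IsOpen D) (hL : ContinuousOn L D)
    {z w : ℂ} (hz : ∀ i < k, q ^ (2 * i) * z ∈ D) (hw : ∀ j < l, q ^ (2 * j) * w ∈ D) :
    Commute (I q L k z) (I q L l w) ∧ Commute (I q L k z) (t q L l w) := by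
  set B : Set ℂ := (fun s : ℤ => q ^ (2 * s) * z) '' Set.Icc (-(l : ℤ)) k
  have hdense : Dense Bᶜ := ((Set.finite_Icc _ _).image _).countable.dense_compl ℝ
  have : (𝓝[Bᶜ] w).NeBot := mem_closure_iff_nhdsWithin_neBot.1 (hdense w)
  have hmul : ∀ j, Tendsto (fun w' : ℂ => q ^ (2 * j) * w') (𝓝[Bᶜ] w) (𝓝 (q ^ (2 * j) * w)) :=
    fun j => ((continuous_const_mul _).tendsto w).mono_left nhdsWithin_le_nhds
  have hLw : ∀ j < l, Tendsto (fun w' : ℂ => L (q ^ (2 * j) * w')) (𝓝[Bᶜ] w)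
      (𝓝 (L (q ^ (2 * j) * w))) := fun j hj =>
    (hL.continuousAt (hD.mem_nhds (hw j hj))).tendsto.comp (hmul j)
  have hmem : ∀ᶠ w' in 𝓝[Bᶜ] w, ∀ j < l, q ^ (2 * j) * w' ∈ D :=
    (Set.finite_Iio l).eventually_all.2 fun j hj => (hmul j).eventually (hD.mem_nhds (hw j hj))
  have hcomm : ∀ᶠ w' in 𝓝[Bᶜ] w,
      Commute (I q L k z) (I q L l w') ∧ Commute (I q L k z) (t q L l w') := by
    filter_upwards [hmem, self_mem_nhdsWithin] with w' hw' hB'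
    exact h.commute hq h0 hz hw' fun s hs hs' heq => hB' ⟨s, ⟨hs, hs'⟩, heq.symm⟩
  exact ⟨commute_of_tendsto (tendsto_qPowTrace hLw) (hcomm.mono fun _ hc => hc.1),
    commute_of_tendsto (tendsto_antisymmTrace hLw) (hcomm.mono fun _ hc => hc.2)⟩

end Continuous

/-! ### Naturality in the coefficient ring -/

section Naturality

variable {S T : Type*} [Ring S] [Ring T] {n : ℕ}

section Maps

variable [Algebra ℂ S] [Algebra ℂ T] (q : ℂ) (φ : S →ₐ[ℂ] T) (M : ℕ → Matrix (Fin n) (Fin n) S)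
  (k : ℕ)

theorem map_qPow : qPow q (fun s => (M s).map φ) k = (qPow q M k).map φ := by
  induction k with
  | zero => exact (Matrix.map_one φ (map_zero φ) (map_one φ)).symm
  | succ k ih =>
    ext i j
    simp only [qPow, ih, qMul, Matrix.of_apply, Matrix.map_apply, map_sum, map_smul, map_mul]

theorem map_qPowTrace : qPowTrace q (fun s => (M s).map φ) k = φ (qPowTrace q M k) := by
  rw [qPowTrace, map_qPow]
  exact (AddMonoidHom.map_trace (φ : S →+ T) _).symm

theorem map_antisymmTrace : antisymmTrace q (fun s => (M s).map φ) k = φ (antisymmTrace q M k) := by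
  have hscalar : scalar T (qAntisymm n k q) = φ.mapMatrix (scalar S (qAntisymm n k q)) := by
    ext I J
    exact (φ.commutes _).symm
  have hleg : ∀ s : Fin k, leg s ((M s).map φ) = φ.mapMatrix (leg s (M s)) := fun s => by
    ext I J
    simp only [leg, Matrix.of_apply, AlgHom.mapMatrix_apply, Matrix.map_apply, apply_ite φ,
      map_zero]
  have hprod : (List.ofFn fun s : Fin k => leg s ((M s).map φ)).prod
      = φ.mapMatrix (List.ofFn fun s : Fin k => leg s (M s)).prod := by
    simp only [hleg, map_list_prod, List.map_ofFn, Function.comp_def]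
  rw [antisymmTrace, hscalar, hprod, ← map_mul]
  exact (AddMonoidHom.map_trace (φ : S →+ T) _).symm

end Maps

section Defect

variable {F : Type*} [CommRing F] [Algebra F S] [Algebra F T] (Q u v : F)

/-- The entries of the difference of the two sides of the relation `RLL Q u v A B`.  Unlike the
relation, it makes sense coefficientwise for series in the spectral parameters. -/
def defect (A B : Matrix (Fin n) (Fin n) S) (i j r s : Fin n) : S :=
  rDiag Q u v i r • (A i j * B r s) + rPerm Q u v i r • (A r j * B i s)
    - (rDiag Q u v j s • (B r s * A i j) + rPerm Q u v s j • (B r j * A i s))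

theorem defect_smul (c d : F) (A B : Matrix (Fin n) (Fin n) S) (i j r s : Fin n) :
    defect Q u v (c • A) (d • B) i j r s = (c * d) • defect Q u v A B i j r s := by
  simp only [defect, Matrix.smul_apply, smul_sub, smul_add, smul_mul_smul_comm,
    smul_comm (c * d), mul_comm d c]

theorem map_defect (φ : S →ₐ[F] T) (A B : Matrix (Fin n) (Fin n) S) (i j r s : Fin n) :
    defect Q u v (A.map φ) (B.map φ) i j r s = φ (defect Q u v A B i j r s) := by
  simp only [defect, Matrix.map_apply, map_sub, map_add, map_smul, map_mul]

variable {K : Type*} [CommRing K] [Algebra F K]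

theorem rDiag_algebraMap (u v : K) (i j : Fin n) :
    rDiag (algebraMap F K Q) u v i j
      = u * algebraMap F K (rDiag Q 1 0 i j) + v * algebraMap F K (rDiag Q 0 1 i j) := by
  simp only [rDiag]
  split_ifs <;> simp only [map_sub, map_mul, map_pow, map_one, map_zero] <;> ring

theorem rPerm_algebraMap (u v : K) (i j : Fin n) :
    rPerm (algebraMap F K Q) u v i j
      = u * algebraMap F K (rPerm Q 1 0 i j) + v * algebraMap F K (rPerm Q 0 1 i j) := by
  simp only [rPerm]
  split_ifs <;> simp only [map_sub, map_mul, map_pow, map_one, map_zero] <;> ring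

theorem rll_algebraMap_iff [Algebra K S] [IsScalarTower F K S] (u v : K)
    (A B : Matrix (Fin n) (Fin n) S) :
    RLL (algebraMap F K Q) u v A B ↔
      ∀ i j r s, u • defect Q 1 0 A B i j r s + v • defect Q 0 1 A B i j r s = 0 := by
  refine forall₄_congr fun i j r s => ?_
  rw [← sub_eq_zero]
  refine Eq.congr_left ?_
  simp only [defect, rDiag_algebraMap, rPerm_algebraMap, add_smul, mul_smul, algebraMap_smul,
    smul_sub, smul_add]
  abel

end Defect

end Naturality

/-! ### Formal series -/

section Series

theorem commute_of_coeff {Γ R : Type*} [AddCommMonoid Γ] [PartialOrder Γ]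
    [IsOrderedCancelAddMonoid Γ] [NonUnitalNonAssocSemiring R] {f g : HahnSeries Γ R}
    (h : ∀ a b, Commute (f.coeff a) (g.coeff b)) : Commute f g := by
  ext N
  rw [HahnSeries.coeff_mul, HahnSeries.coeff_mul]
  have hswap : ∀ {f g : HahnSeries Γ R}, ∀ x ∈ Finset.antidiagonal f.isPWO_support
      g.isPWO_support N, x.swap ∈ Finset.antidiagonal g.isPWO_support f.isPWO_support N :=
    fun x hx => by simpa only [Finset.swap_mem_antidiagonal] using hx
  exact Finset.sum_nbij' Prod.swap Prod.swap hswap hswap (fun _ _ => Prod.swap_swap _)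
    (fun _ _ => Prod.swap_swap _) fun x _ => h x.1 x.2

section Coefficients

variable {R : Type*} [Ring R] {f g : LaurentSeries R} {N m : ℤ} {s : Finset ℤ}

theorem coeff_mul_eq_sum (hs : Finset.Icc m (N - m) ⊆ s) (hf : ∀ p < m, f.coeff p = 0)
    (hg : ∀ p < m, g.coeff p = 0) :
    (f * g).coeff N = ∑ p ∈ s, f.coeff p * g.coeff (N - p) := by
  rw [HahnSeries.coeff_mul]
  refine Finset.sum_of_injOn Prod.fst ?_ ?_ ?_ ?_
  · rintro ⟨a, b⟩ hab ⟨c, d⟩ hcd (rfl : a = c)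
    simp only [Finset.mem_coe, Finset.mem_antidiagonal] at hab hcd
    exact Prod.ext rfl (by omega)
  · rintro ⟨a, b⟩ hab
    simp only [Finset.mem_coe, Finset.mem_antidiagonal, HahnSeries.mem_support] at hab
    have ha : m ≤ a := not_lt.1 fun h => hab.1 (hf a h)
    have hb : m ≤ b := not_lt.1 fun h => hab.2.1 (hg b h)
    exact hs (Finset.mem_Icc.2 ⟨ha, by simp only; omega⟩)
  · intro p _ hp
    by_contra h
    refine hp ⟨(p, N - p), ?_, rfl⟩
    simp only [Finset.mem_coe, Finset.mem_antidiagonal, HahnSeries.mem_support]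
    exact ⟨left_ne_zero_of_mul h, right_ne_zero_of_mul h, by ring⟩
  · rintro ⟨a, b⟩ hab
    simp only [Finset.mem_antidiagonal] at hab
    rw [show N - a = b by omega]

theorem coeff_mul_eq_sum_flip (hs : Finset.Icc m (N - m) ⊆ s) (hf : ∀ p < m, f.coeff p = 0)
    (hg : ∀ p < m, g.coeff p = 0) :
    (g * f).coeff N = ∑ p ∈ s, g.coeff (N - p) * f.coeff p := by
  have himage : Finset.Icc m (N - m) ⊆ s.image (N - ·) := fun p hp => by
    rw [Finset.mem_Icc] at hp
    exact Finset.mem_image.2 ⟨N - p, hs (Finset.mem_Icc.2 ⟨by omega, by omega⟩), by omega⟩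
  rw [coeff_mul_eq_sum himage hg hf, Finset.sum_image sub_right_injective.injOn]
  simp only [sub_sub_cancel]

end Coefficients

variable {S : Type*} [Ring S] {n : ℕ}

/-- The matrix of the coefficients at the `p`-th power of the variable. -/
abbrev coeffMatrix (L : Matrix (Fin n) (Fin n) (LaurentSeries S)) (p : ℤ) :
    Matrix (Fin n) (Fin n) S :=
  L.map fun f => f.coeff p

theorem exists_forall_lt_coeff_eq_zero (L : Matrix (Fin n) (Fin n) (LaurentSeries S)) :
    ∃ m : ℤ, ∀ i j, ∀ p < m, (L i j).coeff p = 0 := by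
  obtain ⟨m, hm⟩ := (Set.finite_range fun x : Fin n × Fin n => (L x.1 x.2).order).bddBelow
  exact ⟨m, fun i j p hp => HahnSeries.coeff_eq_zero_of_lt_order (hp.trans_le (hm ⟨(i, j), rfl⟩))⟩

variable [Algebra ℂ S] {q : ℂ}

theorem coeff_defect {A B : Matrix (Fin n) (Fin n) (LaurentSeries S)} {N m : ℤ} {s : Finset ℤ}
    (hs : Finset.Icc m (N - m) ⊆ s) (hA : ∀ i j, ∀ p < m, (A i j).coeff p = 0)
    (hB : ∀ i j, ∀ p < m, (B i j).coeff p = 0) (u v : ℂ) (i j k l : Fin n) :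
    (defect q u v A B i j k l).coeff N
      = ∑ p ∈ s, defect q u v (coeffMatrix A p) (coeffMatrix B (N - p)) i j k l := by
  simp only [defect, HahnSeries.coeff_sub, HahnSeries.coeff_add, HahnSeries.coeff_smul,
    coeff_mul_eq_sum hs (hA _ _) (hB _ _), coeff_mul_eq_sum_flip hs (hA _ _) (hB _ _),
    Finset.smul_sum, Finset.sum_sub_distrib, Finset.sum_add_distrib, Matrix.map_apply]

/-! ### The `RLL` relation for a formal series and its shifts -/

variable {ε : ℤˣ} {L : Matrix (Fin n) (Fin n) (LaurentSeries S)}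

theorem coe_units_mul_self (ε : ℤˣ) : (ε : ℤ) * ε = 1 := by
  rw [← Units.val_mul, Int.units_mul_self, Units.val_one]

theorem mul_zpow_zpow_sub_units {c : ℂ} (hc : c ≠ 0) (ε : ℤˣ) (p : ℤ) :
    c * (c ^ (ε : ℤ)) ^ (p - ε) = (c ^ (ε : ℤ)) ^ p := by
  rw [zpow_sub₀ (zpow_ne_zero _ hc), ← zpow_mul c ε ε, coe_units_mul_self, zpow_one,
    mul_div_cancel₀ _ hc]

theorem coeffMatrix_formalShift (s : ℕ) (p : ℤ) :
    coeffMatrix (formalShift q ε L s) p = ((q ^ (2 * s)) ^ (ε : ℤ)) ^ p • coeffMatrix L p := rfl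

theorem RLLFormal.defect_add_defect (h : RLLFormal q ε L) (hq : q ≠ 0) (p r : ℤ)
    (i j k l : Fin n) :
    defect q 1 0 (coeffMatrix L (p - ε)) (coeffMatrix L r) i j k l
      + defect q 0 1 (coeffMatrix L p) (coeffMatrix L (r - ε)) i j k l = 0 := by
  have hentry := congrArg (fun X => q • X (i, k) (j, l)) (h (ε * p) (ε * r))
  simp only [Matrix.add_apply, smul_add, smul_Rnum_mul_apply hq, smul_mul_Rnum_apply hq, coeff12,
    coeff21, kronecker_one_mul_apply, one_kronecker_mul_apply, zCoeff, Matrix.map_apply, mul_sub,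
    ← mul_assoc (ε : ℤ) ε, coe_units_mul_self, one_mul, mul_one] at hentry
  rw [← sub_eq_zero] at hentry
  rw [← hentry]
  simp only [defect, Matrix.map_apply]
  abel

theorem RLLFormal.defect_formalShift_coeff (h : RLLFormal q ε L) (hq : q ≠ 0) (a b : ℕ) (p r : ℤ)
    (i j k l : Fin n) :
    q ^ (2 * a) • defect q 1 0 (coeffMatrix (formalShift q ε L a) (p - ε))
        (coeffMatrix (formalShift q ε L b) r) i j k l
      + q ^ (2 * b) • defect q 0 1 (coeffMatrix (formalShift q ε L a) p)
        (coeffMatrix (formalShift q ε L b) (r - ε)) i j k l = 0 := by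
  simp only [coeffMatrix_formalShift, defect_smul, smul_smul]
  rw [← mul_assoc, mul_zpow_zpow_sub_units (pow_ne_zero _ hq), mul_left_comm,
    mul_zpow_zpow_sub_units (pow_ne_zero _ hq), ← smul_add, h.defect_add_defect hq, smul_zero]

theorem RLLFormal.defect_formalShift (h : RLLFormal q ε L) (hq : q ≠ 0) (a b : ℕ)
    (i j k l : Fin n) :
    q ^ (2 * a) • defect q 1 0 (formalShift q ε L a) (formalShift q ε L b) i j k l
      + q ^ (2 * b) • defect q 0 1 (formalShift q ε L a) (formalShift q ε L b) i j k l = 0 := by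
  obtain ⟨m, hm⟩ := exists_forall_lt_coeff_eq_zero L
  have hm' : ∀ s i j, ∀ p < m, (formalShift q ε L s i j).coeff p = 0 := fun s i j p hp => by
    change ((q ^ (2 * s)) ^ (ε : ℤ)) ^ p • (L i j).coeff p = 0
    rw [hm i j p hp, smul_zero]
  have hε : (ε : ℤ) = 1 ∨ (ε : ℤ) = -1 := Int.isUnit_iff.1 ε.isUnit
  ext N
  have hIcc : Finset.Icc m (N - m) ⊆ Finset.Icc (m - 1) (N - m + 1) :=
    Finset.Icc_subset_Icc (by omega) (by omega)
  have himage : Finset.Icc m (N - m) ⊆ (Finset.Icc (m - 1) (N - m + 1)).image (· - (ε : ℤ)) :=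
    fun p hp => by
      rw [Finset.mem_Icc] at hp
      exact Finset.mem_image.2 ⟨p + ε, Finset.mem_Icc.2 ⟨by omega, by omega⟩, by omega⟩
  rw [HahnSeries.coeff_add, HahnSeries.coeff_smul, HahnSeries.coeff_smul,
    coeff_defect himage (hm' a) (hm' b), coeff_defect hIcc (hm' a) (hm' b),
    Finset.sum_image sub_left_injective.injOn, Finset.smul_sum, Finset.smul_sum,
    ← Finset.sum_add_distrib]
  refine Finset.sum_eq_zero fun p _ => ?_
  rw [← h.defect_formalShift_coeff hq a b p (N - (p - ε)) i j k l, sub_sub, sub_add_cancel]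

theorem RLLFormal.isRLLString {K T : Type*} [Field K] [Ring T] [Algebra ℂ K] [Algebra K T]
    [Algebra ℂ T] [IsScalarTower ℂ K T] (h : RLLFormal q ε L) (hq : q ≠ 0)
    (φ : LaurentSeries S →ₐ[ℂ] T) {x : K} (hx : x ≠ 0) (k : ℕ) :
    IsRLLString (algebraMap ℂ K q) k (fun i => algebraMap ℂ K (q ^ (2 * i)) * x)
      fun i => (formalShift q ε L i).map φ where
  isUnit i _ := (mul_ne_zero ((map_ne_zero _).2 (pow_ne_zero _ hq)) hx).isUnit
  succ i _ := by
    simp only [map_pow]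
    ring
  rll i _ := (rll_algebraMap_iff _ _ _ _ _).2 fun i₁ j₁ i₂ j₂ => by
    rw [mul_comm, mul_comm _ x, mul_smul, mul_smul, ← smul_add, algebraMap_smul, algebraMap_smul,
      map_defect, map_defect, ← map_smul, ← map_smul, ← map_add, h.defect_formalShift hq, map_zero,
      smul_zero]

end Series

/-! ### Laurent series in two variables -/

section TwoVariables

/-- The ring homomorphism of Laurent series induced by one of coefficient rings. -/
def seriesMap {R S : Type*} [Ring R] [Ring S] (φ : R →+* S) :
    LaurentSeries R →+* LaurentSeries S where
  toFun f := f.map φ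
  map_one' := HahnSeries.map_one φ.toMonoidWithZeroHom
  map_mul' _ _ := HahnSeries.map_mul φ.toNonUnitalRingHom
  map_zero' := HahnSeries.map_zero φ.toMonoidWithZeroHom.toZeroHom
  map_add' _ _ := HahnSeries.map_add φ.toAddMonoidHom

variable {S : Type*} [Ring S] [Algebra ℂ S] {n : ℕ} {q : ℂ}

/-- The embedding of the series in the first (inner) of two variables. -/
def firstVar : LaurentSeries S →ₐ[ℂ] LaurentSeries (LaurentSeries S) :=
  { HahnSeries.C with commutes' := fun _ => rfl }

/-- The embedding of the series in the second (outer) of two variables. -/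
def secondVar : LaurentSeries S →ₐ[ℂ] LaurentSeries (LaurentSeries S) :=
  { seriesMap (HahnSeries.C : S →+* LaurentSeries S) with
    commutes' := fun c => HahnSeries.map_C (algebraMap ℂ S c) HahnSeries.C }

theorem coeff_firstVar_mul_secondVar (f g : LaurentSeries S) (p r : ℤ) :
    ((firstVar f * secondVar g).coeff r).coeff p = f.coeff p * g.coeff r := by
  change ((HahnSeries.single 0 f * secondVar g).coeff r).coeff p = _
  rw [HahnSeries.coeff_single_zero_mul]
  exact HahnSeries.coeff_mul_single_zero

theorem coeff_secondVar_mul_firstVar (f g : LaurentSeries S) (p r : ℤ) :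
    ((secondVar g * firstVar f).coeff r).coeff p = g.coeff r * f.coeff p := by
  change ((secondVar g * HahnSeries.single 0 f).coeff r).coeff p = _
  rw [HahnSeries.coeff_mul_single_zero]
  exact HahnSeries.coeff_single_zero_mul

theorem commute_coeff_of_commute {f g : LaurentSeries S}
    (h : Commute (firstVar f) (secondVar g)) (a b : ℤ) : Commute (f.coeff a) (g.coeff b) := by
  have hcoeff := congrArg (fun X => (X.coeff b).coeff a) h.eq
  simp only [coeff_firstVar_mul_secondVar, coeff_secondVar_mul_firstVar] at hcoeff
  exact hcoeff

theorem coeff_defect_firstVar_secondVar (u v : ℂ) (A B : Matrix (Fin n) (Fin n) (LaurentSeries S))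
    (i j k l : Fin n) (p r : ℤ) :
    ((defect q u v (A.map firstVar) (B.map secondVar) i j k l).coeff r).coeff p
      = defect q u v (coeffMatrix A p) (coeffMatrix B r) i j k l := by
  simp only [defect, HahnSeries.coeff_sub, HahnSeries.coeff_add, HahnSeries.coeff_smul,
    Matrix.map_apply, coeff_firstVar_mul_secondVar, coeff_secondVar_mul_firstVar]

/-- The field of complex iterated Laurent series `ℂ((z))((w))`, in which the spectral parameters
`z ^ ε`, `w ^ ε` and the scalars `q² z - w` by which the fusion argument divides are invertible. -/
def BiLaurent : Type := LaurentSeries (LaurentSeries ℂ)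

namespace BiLaurent

instance : Field BiLaurent := inferInstanceAs (Field (LaurentSeries (LaurentSeries ℂ)))

instance : Algebra ℂ BiLaurent := RingHom.toAlgebra
  ((HahnSeries.C : LaurentSeries ℂ →+* LaurentSeries (LaurentSeries ℂ)).comp HahnSeries.C)

/-- The monomial `z ^ a` in the first variable. -/
def fst (a : ℤ) : BiLaurent :=
  (HahnSeries.C (HahnSeries.single a 1) : LaurentSeries (LaurentSeries ℂ))

/-- The monomial `w ^ a` in the second variable. -/
def snd (a : ℤ) : BiLaurent :=
  (HahnSeries.single a 1 : LaurentSeries (LaurentSeries ℂ))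

theorem fst_ne_zero (a : ℤ) : fst a ≠ 0 :=
  HahnSeries.C_ne_zero (HahnSeries.single_ne_zero one_ne_zero)

theorem snd_ne_zero (a : ℤ) : snd a ≠ 0 :=
  HahnSeries.single_ne_zero (one_ne_zero : (1 : LaurentSeries ℂ) ≠ 0)

theorem mul_fst_ne_mul_snd {a : ℤ} (ha : a ≠ 0) {α : ℂ} (hα : α ≠ 0) (β : ℂ) :
    algebraMap ℂ BiLaurent α * fst a ≠ algebraMap ℂ BiLaurent β * snd a := by
  suffices (HahnSeries.C (HahnSeries.C α) * HahnSeries.C (HahnSeries.single a 1) :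
      LaurentSeries (LaurentSeries ℂ)) ≠
        HahnSeries.C (HahnSeries.C β) * HahnSeries.single a 1 from this
  intro heq
  have hcoeff := congrArg (fun X => (X.coeff 0).coeff a) heq
  simp only [HahnSeries.C_apply, HahnSeries.coeff_single_zero_mul,
    HahnSeries.coeff_single_of_ne ha.symm, HahnSeries.coeff_single_same, mul_zero,
    HahnSeries.coeff_zero, mul_one] at hcoeff
  exact hα hcoeff

/-- The coefficientwise embedding of the complex series into those over a `ℂ`-algebra. -/
def toSeries (S : Type*) [Ring S] [Algebra ℂ S] :
    BiLaurent →+* LaurentSeries (LaurentSeries S) :=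
  seriesMap (seriesMap (algebraMap ℂ S))

theorem toSeries_commute (f : BiLaurent) (g : LaurentSeries (LaurentSeries S)) :
    Commute (toSeries S f) g :=
  commute_of_coeff fun _ _ => commute_of_coeff fun _ _ => Algebra.commutes _ _

instance : Algebra BiLaurent (LaurentSeries (LaurentSeries S)) :=
  (toSeries S).toAlgebra' toSeries_commute

theorem toSeries_algebraMap (c : ℂ) :
    toSeries S (algebraMap ℂ BiLaurent c) = algebraMap ℂ (LaurentSeries (LaurentSeries S)) c := by
  change seriesMap (seriesMap (algebraMap ℂ S)) (HahnSeries.C (HahnSeries.C c))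
    = HahnSeries.C (HahnSeries.C (algebraMap ℂ S c))
  exact (HahnSeries.map_C _ _).trans (congrArg _ (HahnSeries.map_C _ _))

instance : IsScalarTower ℂ BiLaurent (LaurentSeries (LaurentSeries S)) :=
  .of_algebraMap_eq fun c => (toSeries_algebraMap c).symm

theorem toSeries_fst (a : ℤ) :
    toSeries S (fst a) = HahnSeries.single 0 (HahnSeries.single a 1) := by
  refine (HahnSeries.map_C _ _).trans (congrArg _ ?_)
  exact (HahnSeries.map_single (algebraMap ℂ S).toMonoidWithZeroHom.toZeroHom).trans
    (congrArg _ (map_one (algebraMap ℂ S)))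

theorem toSeries_snd (a : ℤ) : toSeries S (snd a) = HahnSeries.single a 1 :=
  (HahnSeries.map_single (seriesMap (algebraMap ℂ S)).toMonoidWithZeroHom.toZeroHom).trans
    (congrArg _ (map_one (seriesMap (algebraMap ℂ S))))

theorem coeff_fst_smul (a : ℤ) (X : LaurentSeries (LaurentSeries S)) (p r : ℤ) :
    ((fst a • X).coeff r).coeff p = (X.coeff r).coeff (p - a) := by
  change ((toSeries S (fst a) * X).coeff r).coeff p = _
  rw [toSeries_fst, HahnSeries.coeff_single_zero_mul, HahnSeries.coeff_single_mul, one_mul]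

theorem coeff_snd_smul (a : ℤ) (X : LaurentSeries (LaurentSeries S)) (r : ℤ) :
    (snd a • X).coeff r = X.coeff (r - a) := by
  change (toSeries S (snd a) * X).coeff r = _
  rw [toSeries_snd, HahnSeries.coeff_single_mul, one_mul]

end BiLaurent

variable {ε : ℤˣ} {L : Matrix (Fin n) (Fin n) (LaurentSeries S)}

theorem RLLFormal.isRLLPair (h : RLLFormal q ε L) (hq : q ≠ 0) (k l : ℕ) :
    IsRLLPair (algebraMap ℂ BiLaurent q) k l
      (fun i => algebraMap ℂ BiLaurent (q ^ (2 * i)) * BiLaurent.fst ε)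
      (fun j => algebraMap ℂ BiLaurent (q ^ (2 * j)) * BiLaurent.snd ε)
      (fun i => (formalShift q ε L i).map firstVar)
      fun j => (formalShift q ε L j).map secondVar where
  isUnit_left i _ j _ := by
    rw [← mul_assoc, ← map_pow, ← map_mul]
    exact (sub_ne_zero.2 (BiLaurent.mul_fst_ne_mul_snd ε.ne_zero
      (mul_ne_zero (pow_ne_zero _ hq) (pow_ne_zero _ hq)) _)).isUnit
  isUnit_right i _ j _ := by
    rw [← mul_assoc, ← map_pow, ← map_mul]
    exact (sub_ne_zero.2 (BiLaurent.mul_fst_ne_mul_snd ε.ne_zero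
      (pow_ne_zero _ hq) _).symm).isUnit
  rll i _ j _ := (rll_algebraMap_iff _ _ _ _ _).2 fun i₁ j₁ i₂ j₂ => by
    rw [mul_smul, mul_smul, algebraMap_smul, algebraMap_smul]
    ext r p
    simpa only [HahnSeries.coeff_add, HahnSeries.coeff_smul, BiLaurent.coeff_fst_smul,
      BiLaurent.coeff_snd_smul, coeff_defect_firstVar_secondVar, HahnSeries.coeff_zero]
      using h.defect_formalShift_coeff hq i j p r i₁ j₁ i₂ j₂

theorem RLLFormal.commute_coeff (h : RLLFormal q ε L) (hq : q ≠ 0) (k l : ℕ) (a b : ℤ) :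
    Commute ((formalI q ε L k).coeff a) ((formalI q ε L l).coeff b) ∧
      Commute ((formalI q ε L k).coeff a) ((formalT q ε L l).coeff b) := by
  have hcomm := (h.isRLLPair hq k l).commute hq
    (h.isRLLString hq firstVar (BiLaurent.fst_ne_zero ε) k)
    (h.isRLLString hq secondVar (BiLaurent.snd_ne_zero ε) l)
  simp only [map_qPowTrace, map_antisymmTrace] at hcomm
  exact hcomm.imp (commute_coeff_of_commute · a b) (commute_coeff_of_commute · a b)

end TwoVariables

end

end QLax

theorem mainTheorem5 {𝓡 : Type*} [Ring 𝓡] [Algebra ℂ 𝓡] (n : ℕ) (q : ℂ) (hq : q ≠ 0) :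
    -- formal Laurent series in `z` or in `z⁻¹`: all coefficients commute
    (∀ (ε : ℤˣ) (L : Matrix (Fin n) (Fin n) (LaurentSeries 𝓡)), QLax.RLLFormal q ε L →
      ∀ k l : ℕ, 0 < k → 0 < l → ∀ a b : ℤ,
        Commute ((QLax.formalI q ε L k).coeff a) ((QLax.formalI q ε L l).coeff b) ∧
        Commute ((QLax.formalI q ε L k).coeff a) ((QLax.formalT q ε L l).coeff b)) ∧
    -- arbitrary functions of a complex parameter, where the `R`-matrices are regular, invertible
    (∀ (D : Set ℂ) (L : ℂ → Matrix (Fin n) (Fin n) 𝓡), (0 : ℂ) ∉ D → QLax.RLLOn q D L →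
      ∀ k l : ℕ, 0 < k → 0 < l → ∀ z w : ℂ,
        (∀ i < k, q ^ (2 * i) * z ∈ D) → (∀ j < l, q ^ (2 * j) * w ∈ D) →
        (∀ s : ℤ, -(l : ℤ) ≤ s → s ≤ k → w ≠ q ^ (2 * s) * z) →
        Commute (QLax.I q L k z) (QLax.I q L l w) ∧
        Commute (QLax.I q L k z) (QLax.t q L l w)) ∧
    -- continuous functions of a complex parameter: all values of the parameters
    (∀ [TopologicalSpace 𝓡] [IsTopologicalRing 𝓡] [T2Space 𝓡]
      (D : Set ℂ) (L : ℂ → Matrix (Fin n) (Fin n) 𝓡), IsOpen D → (0 : ℂ) ∉ D →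
      ContinuousOn L D → QLax.RLLOn q D L →
      ∀ k l : ℕ, 0 < k → 0 < l → ∀ z w : ℂ,
        (∀ i < k, q ^ (2 * i) * z ∈ D) → (∀ j < l, q ^ (2 * j) * w ∈ D) →
        Commute (QLax.I q L k z) (QLax.I q L l w) ∧
        Commute (QLax.I q L k z) (QLax.t q L l w)) :=
  ⟨fun _ _ h k l _ _ a b => h.commute_coeff hq k l a b,
    fun _ _ h0 h _ _ _ _ _ _ hz hw hzw => h.commute hq h0 hz hw hzw,
    fun _ _ hD h0 hL h _ _ _ _ _ _ hz hw => h.commute_of_continuousOn hq h0 hD hL hz hw⟩
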